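/- **Theorem (two singularities).** Let $B$ be an infinite Blaschke product $$B(z)=\lambda z^p\prod_{j\ge 1}\frac{|a_j|}{a_j}\,\frac{a_j-z}{1-\overline{a_j}z},\qquad |\lambda|=1,\ p\ge 0,\ 0<|a_j|<1,\ \sum_j(1-|a_j|)<\infty .$$ Its spectrum $\sigma(B)$ is the set of points $\zeta\in\mathbb T$ such that $B$ has no analytic extension to a neighbourhood of $\zeta$; at the other (regular) points of $\mathbb T$, $B$ denotes the value of the extension. Suppose that $\sigma(B)$ consists of exactly two points $e^{i\theta_0},e^{i\theta_1}$, where $\theta_0<\theta_1<\theta_0+2\pi$. Let $G$ be the set, with composition, of the continuous maps $x:\mathbb T\to\mathbb T$ that map singular points to singular points and regular points to regular points and satisfy $B(x(\zeta))=B(\zeta)$ at every regular point $\zeta$. Then $G$ is a group, isomorphic to one of $$\{e\},\qquad \mathbb Z_2,\qquad \mathbb Z,\qquad \mathbb Z^2\rtimes\mathbb Z_2,$$ where $\mathbb Z_2$ acts on $\mathbb Z^2$ by interchanging the coordinates, and $$\mathbb Z^2\rtimes\mathbb Z_2\cong\langle x_1,x_2,y:\ y^2=e,\ x_1x_2=x_2x_1,\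 x_2y=yx_1\rangle .$$ Which group occurs is determined as follows. Say that an open arc of $\mathbb T$, described counterclockwise from its initial to its final point, is of type $0$ if $B=1$ has only finitely many solutions in it, and of type $1_a$, $1_b$ or $2$ if there are infinitely many solutions and their accumulation points are precisely the initial point, precisely the final point, or precisely both end points, respectively. Let $I_1$ be the arc from $e^{i\theta_0}$ to $e^{i\theta_1}$ and $I_2$ the arc from $e^{i\theta_1}$ to $e^{i\theta_0}$. Each of $I_1,I_2$ is of one of these four types, and: 1. If both arcs are of type $2$, then $G\cong\mathbb Z^2\rtimes\mathbb Z_2$. 2. If exactly one of the arcs is of type $2$, then $G\cong\mathbb Z$. 3. If neither arc is of type $2$, then either both are of type $1_a$, or both are of type $1_b$. In the first case the limits $L_k=\lim_{\alpha\to\theta_k^-}B(e^{i\alpha})$ $(k=0,1)$ exist, in the second case the limits $L_k=\lim_{\alpha\to\theta_k^+}B(e^{i\alpha})$ $(k=0,1)$ exist; in either case $G\cong\mathbb Z_2$ if $L_0=L_1$, and $G\cong\{e\}$ if $L_0\ne L_1$. -/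

import Mathlib

open Filter Topology

noncomputable section

/-- The elementary Blaschke factor with zero `a` (for `0 < ‖a‖ < 1`). -/
def blaschkeFactor (a z : ℂ) : ℂ :=
  ((‖a‖ : ℂ) / a) * ((a - z) / (1 - (starRingEnd ℂ) a * z))

/-- On the open unit disc, `B` is the infinite Blaschke product
`c z ^ p ∏ j, (|a j| / a j) (a j - z) / (1 - conj (a j) z)` with `|c| = 1`, zeros `a j` in the
punctured disc (repetitions allowed) and `∑ j, (1 - |a j|) < ∞`. The Blaschke condition makes the
product converge absolutely at every point of the disc. Values of `B` off the disc play no role. -/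
def IsBlaschkeProduct (B : ℂ → ℂ) : Prop :=
  ∃ (c : ℂ) (p : ℕ) (a : ℕ → ℂ), ‖c‖ = 1 ∧ (∀ j, a j ≠ 0 ∧ ‖a j‖ < 1) ∧
    Summable (fun j => 1 - ‖a j‖) ∧
    ∀ z ∈ Metric.ball (0 : ℂ) 1, B z = c * z ^ p * ∏' j, blaschkeFactor (a j) z

/-- The points of the unit circle to which the restriction of `f` to the open unit disc does not
extend analytically. -/
def boundarySpectrum (f : ℂ → ℂ) : Set Circle :=
  {ζ | ¬ ∃ g : ℂ → ℂ, AnalyticAt ℂ g (ζ : ℂ) ∧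
    ∀ᶠ z in 𝓝[Metric.ball (0 : ℂ) 1] (ζ : ℂ), g z = f z}

/-- The boundary value of `f` at a point of the circle, as a radial limit. It is only used at points
outside `boundarySpectrum f`, where it exists and is the value of the analytic extension. -/
def boundaryValue (f : ℂ → ℂ) (ζ : Circle) : ℂ :=
  limUnder (𝓝[<] (1 : ℝ)) (fun r : ℝ => f ((r : ℂ) * (ζ : ℂ)))

/-- The continuous invariants of `f`, under composition: continuous self-maps `x` of the circle
which map singular points to singular points and regular points to regular points, and
satisfy `f ∘ x = f` at the regular points. (Multiplication in `Function.End` is composition.) -/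
def continuousInvariants (f : ℂ → ℂ) : Submonoid (Function.End Circle) where
  carrier := {x | Continuous (fun ζ : Circle => x ζ) ∧
    (∀ ζ, ζ ∈ boundarySpectrum f → x ζ ∈ boundarySpectrum f) ∧
    (∀ ζ, ζ ∉ boundarySpectrum f → x ζ ∉ boundarySpectrum f) ∧
    (∀ ζ, ζ ∉ boundarySpectrum f → boundaryValue f (x ζ) = boundaryValue f ζ)}
  one_mem' := ⟨continuous_id, fun _ h => h, fun _ h => h, fun _ _ => rfl⟩
  mul_mem' := by
    rintro x y ⟨hx, hxs, hxr, hxv⟩ ⟨hy, hys, hyr, hyv⟩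
    exact ⟨hx.comp hy, fun ζ h => hxs _ (hys ζ h), fun ζ h => hxr _ (hyr ζ h),
      fun ζ h => (hxv _ (hyr ζ h)).trans (hyv ζ h)⟩

/-- The open arc of the circle from `e ^ (i s)` counterclockwise to `e ^ (i t)`
(for `s < t ≤ s + 2 π`). -/
def openArc (s t : ℝ) : Set Circle := Circle.exp '' Set.Ioo s t

/-- The solutions of `f = 1` in the arc from `e ^ (i s)` to `e ^ (i t)`. -/
def arcSolutions (f : ℂ → ℂ) (s t : ℝ) : Set Circle :=
  {ζ ∈ openArc s t | boundaryValue f ζ = 1}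

/-- Type `0`: only finitely many solutions of `f = 1` in the arc. -/
def IsArcType0 (f : ℂ → ℂ) (s t : ℝ) : Prop := (arcSolutions f s t).Finite

/-- Type `1_a`: infinitely many solutions, accumulating precisely at the initial point. -/
def IsArcType1a (f : ℂ → ℂ) (s t : ℝ) : Prop :=
  (arcSolutions f s t).Infinite ∧ derivedSet (arcSolutions f s t) = {Circle.exp s}

/-- Type `1_b`: infinitely many solutions, accumulating precisely at the final point. -/
def IsArcType1b (f : ℂ → ℂ) (s t : ℝ) : Prop :=
  (arcSolutions f s t).Infinite ∧ derivedSet (arcSolutions f s t) = {Circle.exp t}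

/-- Type `2`: infinitely many solutions, accumulating precisely at both end points. -/
def IsArcType2 (f : ℂ → ℂ) (s t : ℝ) : Prop :=
  (arcSolutions f s t).Infinite ∧ derivedSet (arcSolutions f s t) = {Circle.exp s, Circle.exp t}

/-- `lim_{α → θ⁻} f (e ^ (i α)) = L`. -/
def HasLimitFromBelow (f : ℂ → ℂ) (θ : ℝ) (L : ℂ) : Prop :=
  Tendsto (fun α : ℝ => boundaryValue f (Circle.exp α)) (𝓝[<] θ) (𝓝 L)

/-- `lim_{α → θ⁺} f (e ^ (i α)) = L`. -/
def HasLimitFromAbove (f : ℂ → ℂ) (θ : ℝ) (L : ℂ) : Prop :=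
  Tendsto (fun α : ℝ => boundaryValue f (Circle.exp α)) (𝓝[>] θ) (𝓝 L)

/-- The action of `ℤ/2` on `ℤ × ℤ` (written multiplicatively) by interchanging the coordinates. -/
def coordinateSwapAction :
    Multiplicative (ZMod 2) →* MulAut (Multiplicative ℤ × Multiplicative ℤ) where
  toFun g := if g = 1 then 1 else MulEquiv.prodComm
  map_one' := if_pos rfl
  map_mul' := by
    have h : ∀ g : Multiplicative (ZMod 2), g = 1 ∨ g = Multiplicative.ofAdd 1 := by decide
    have h1 : (Multiplicative.ofAdd (1 : ZMod 2)) ≠ 1 := by decide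
    have h2 : (Multiplicative.ofAdd (1 : ZMod 2)) * Multiplicative.ofAdd 1 = 1 := by decide
    intro g k
    rcases h g with rfl | rfl <;> rcases h k with rfl | rfl <;> simp only [h1, h2, mul_one, one_mul,
      if_true, if_false]
    ext1 v
    rfl

/-- The semidirect product `ℤ² ⋊ ℤ/2`, the action interchanging the coordinates. -/
abbrev ZSqSemidirectZTwo : Type :=
  (Multiplicative ℤ × Multiplicative ℤ) ⋊[coordinateSwapAction] Multiplicative (ZMod 2)

/-- The three generators of the presentation. -/
inductive PresentationGenerator : Type
  | x₁ | x₂ | y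

/-- The relators of `y ^ 2 = e`, `x₁ x₂ = x₂ x₁`, `x₂ y = y x₁`. -/
def presentationRelators : Set (FreeGroup PresentationGenerator) :=
  let x₁ := FreeGroup.of PresentationGenerator.x₁
  let x₂ := FreeGroup.of PresentationGenerator.x₂
  let y := FreeGroup.of PresentationGenerator.y
  {y ^ 2, (x₁ * x₂) * (x₂ * x₁)⁻¹, (x₂ * y) * (y * x₁)⁻¹}

end

/-! ### Elementary Blaschke factors -/

theorem blaschkeFactor_sub_one {a z : ℂ} (ha : a ≠ 0) (hz : 1 - (starRingEnd ℂ) a * z ≠ 0) :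
    blaschkeFactor a z - 1 =
      -((1 - ‖a‖ : ℝ) * (a + ‖a‖ * z)) / (a * (1 - (starRingEnd ℂ) a * z)) := by
  have h : a * (starRingEnd ℂ) a = (‖a‖ : ℂ) ^ 2 := Complex.mul_conj' a
  have h1 : blaschkeFactor a z * (a * (1 - (starRingEnd ℂ) a * z)) = ‖a‖ * (a - z) := by
    rw [blaschkeFactor, div_mul_div_comm, div_mul_cancel₀ _ (mul_ne_zero ha hz)]
  rw [eq_div_iff (mul_ne_zero ha hz), sub_mul, h1]
  push_cast
  linear_combination z * h

/-- The factor $1-|a|$ is what the Blaschke condition sums; the constant is uniform on bounded sets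
away from the poles. -/
theorem norm_blaschkeFactor_sub_one_le {a z : ℂ} {δ : ℝ} (hδ : 0 < δ) (ha : a ≠ 0)
    (ha1 : ‖a‖ < 1) (hz : δ ≤ ‖1 - (starRingEnd ℂ) a * z‖) :
    ‖blaschkeFactor a z - 1‖ ≤ (1 + ‖z‖) / δ * (1 - ‖a‖) := by
  have h0 : 1 - (starRingEnd ℂ) a * z ≠ 0 := norm_pos_iff.1 (hδ.trans_le hz)
  have ha' : 0 < ‖a‖ := norm_pos_iff.2 ha
  have h1 : ‖a + ‖a‖ * z‖ ≤ ‖a‖ * (1 + ‖z‖) :=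
    (norm_add_le _ _).trans (by simp [mul_add])
  have h2 : (0 : ℝ) < 1 - ‖a‖ := by linarith
  rw [blaschkeFactor_sub_one ha h0, norm_div, norm_neg, norm_mul, norm_mul, Complex.norm_real,
    Real.norm_of_nonneg h2.le]
  calc (1 - ‖a‖) * ‖a + ‖a‖ * z‖ / (‖a‖ * ‖1 - (starRingEnd ℂ) a * z‖)
      ≤ (1 - ‖a‖) * (‖a‖ * (1 + ‖z‖)) / (‖a‖ * δ) := by gcongr
    _ = (1 + ‖z‖) / δ * (1 - ‖a‖) := by field_simp

/-- Since $\zeta\bar\zeta=1$. On the circle, distance from the zeros thus bounds the denominators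
from below. -/
theorem norm_one_sub_conj_mul {a ζ : ℂ} (hζ : ‖ζ‖ = 1) :
    ‖1 - (starRingEnd ℂ) a * ζ‖ = ‖ζ - a‖ := by
  have h : ζ * (starRingEnd ℂ) ζ = 1 := by simp [Complex.mul_conj', hζ]
  have : 1 - (starRingEnd ℂ) a * ζ = ζ * (starRingEnd ℂ) (ζ - a) := by
    rw [map_sub, mul_sub, h]; ring
  rw [this, norm_mul, hζ, RCLike.norm_conj, one_mul]

theorem norm_blaschkeFactor_circle {a : ℂ} (ha : a ≠ 0) (ha1 : ‖a‖ < 1) {ζ : ℂ} (hζ : ‖ζ‖ = 1) :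
    ‖blaschkeFactor a ζ‖ = 1 := by
  have h : ζ - a ≠ 0 := by
    intro h
    rw [sub_eq_zero] at h
    rw [h] at hζ
    exact ha1.ne hζ
  have ha' := norm_pos_iff.2 ha
  have h' := norm_pos_iff.2 h
  rw [blaschkeFactor, norm_mul, norm_div, norm_div, norm_one_sub_conj_mul hζ, norm_sub_rev a ζ]
  simp [ha'.ne', h'.ne']

/-- The Poisson kernel: the derivative of the argument of a Blaschke factor on the circle. -/
noncomputable def poissonDensity (a : ℂ) (t : ℝ) : ℝ := (1 - ‖a‖ ^ 2) / ‖(Circle.exp t : ℂ) - a‖ ^ 2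

theorem circleExp_sub_ne_zero {a : ℂ} (ha : ‖a‖ < 1) (t : ℝ) : (Circle.exp t : ℂ) - a ≠ 0 := by
  intro h
  rw [sub_eq_zero] at h
  rw [← h, Circle.norm_coe] at ha
  exact lt_irrefl _ ha

theorem continuous_coe_circleExp : Continuous fun t : ℝ => (Circle.exp t : ℂ) :=
  continuous_subtype_val.comp Circle.exp.continuous

theorem continuous_poissonDensity {a : ℂ} (ha : ‖a‖ < 1) : Continuous (poissonDensity a) :=
  continuous_const.div ((continuous_coe_circleExp.sub continuous_const).norm.pow 2)
    fun t => pow_ne_zero _ (norm_ne_zero_iff.2 (circleExp_sub_ne_zero ha t))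

theorem poissonDensity_pos {a : ℂ} (ha : ‖a‖ < 1) (t : ℝ) : 0 < poissonDensity a t := by
  have := norm_pos_iff.2 (circleExp_sub_ne_zero ha t)
  have := norm_nonneg a
  refine div_pos ?_ (by positivity)
  nlinarith

theorem poissonDensity_le {a : ℂ} (ha : ‖a‖ < 1) {t δ : ℝ} (hδ : 0 < δ)
    (h : δ ≤ ‖(Circle.exp t : ℂ) - a‖) : poissonDensity a t ≤ 2 / δ ^ 2 * (1 - ‖a‖) := by
  have h0 := norm_nonneg a
  have h1 : 1 - ‖a‖ ^ 2 ≤ 2 * (1 - ‖a‖) := by nlinarith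
  calc poissonDensity a t ≤ 2 * (1 - ‖a‖) / δ ^ 2 := by
        unfold poissonDensity
        gcongr
    _ = _ := by ring

theorem poissonDensity_periodic (a : ℂ) : Function.Periodic (poissonDensity a) (2 * Real.pi) := by
  intro t
  simp [poissonDensity]

theorem hasDerivAt_blaschkeFactor_circleExp {a : ℂ} (ha : ‖a‖ < 1) (t : ℝ) :
    HasDerivAt (fun t : ℝ => blaschkeFactor a (Circle.exp t))
      (blaschkeFactor a (Circle.exp t) * (poissonDensity a t * Complex.I)) t := by
  have he : HasDerivAt (fun t : ℝ => (Circle.exp t : ℂ)) (Circle.exp t * Complex.I) t := by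
    have h1 : HasDerivAt (fun t : ℝ => (t : ℂ) * Complex.I) (1 * Complex.I) t :=
      (Complex.ofRealCLM.hasDerivAt (x := t)).mul_const _
    simpa [Circle.coe_exp] using h1.cexp
  set e : ℂ := (Circle.exp t : ℂ) with hedef
  have hn : ‖e‖ = 1 := Circle.norm_coe _
  have hd : 1 - (starRingEnd ℂ) a * e ≠ 0 := by
    rw [← norm_pos_iff, norm_one_sub_conj_mul hn]
    exact norm_pos_iff.2 (circleExp_sub_ne_zero ha t)
  have hd' : e - a ≠ 0 := circleExp_sub_ne_zero ha t
  -- From $\bar e e=1$ follows $|e-a|^2=(e-a)(1-\bar a e)/e$, which makes the kernel rational in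
  -- $e$.
  have hp : (poissonDensity a t : ℂ) =
      (1 - (starRingEnd ℂ) a * a) * e / ((e - a) * (1 - (starRingEnd ℂ) a * e)) := by
    have h2 : (starRingEnd ℂ) e * e = 1 := by simp [Complex.conj_mul', hn]
    have h3 : (starRingEnd ℂ) (e - a) * e = 1 - (starRingEnd ℂ) a * e := by
      rw [map_sub, sub_mul, h2]
    have h4 : (starRingEnd ℂ) (e - a) ≠ 0 := (map_ne_zero _).2 hd'
    have h5 : e ≠ 0 := by rintro h; simp [h] at hn
    rw [← h3]
    unfold poissonDensity
    rw [← hedef]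
    push_cast
    rw [← Complex.conj_mul', ← Complex.conj_mul']
    field_simp
  have h := (((hasDerivAt_const t a).sub he).div
    ((hasDerivAt_const t (1 : ℂ)).sub (he.const_mul ((starRingEnd ℂ) a))) hd).const_mul
      ((‖a‖ : ℂ) / a)
  refine h.congr_deriv ?_
  rw [hp, blaschkeFactor, Pi.sub_apply, Pi.sub_apply, ← hedef]
  field_simp
  ring

/-- The factor divided by the exponential has derivative zero. The argument comes from integration,
so no branch of the logarithm has to be chosen. -/
theorem blaschkeFactor_circleExp {a : ℂ} (ha : ‖a‖ < 1) (s t : ℝ) :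
    blaschkeFactor a (Circle.exp t) = blaschkeFactor a (Circle.exp s) *
      Complex.exp ((∫ u in s..t, poissonDensity a u : ℝ) * Complex.I) := by
  have hφ : ∀ t, HasDerivAt (fun t => ∫ u in s..t, poissonDensity a u) (poissonDensity a t) t :=
    fun t => ((continuous_poissonDensity ha).integral_hasStrictDerivAt s t).hasDerivAt
  have hd : ∀ t, HasDerivAt (fun t : ℝ => blaschkeFactor a (Circle.exp t) *
      Complex.exp (-((∫ u in s..t, poissonDensity a u : ℝ) * Complex.I))) 0 t := by
    intro t
    refine ((hasDerivAt_blaschkeFactor_circleExp ha t).mul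
      (((hφ t).ofReal_comp.mul_const Complex.I).neg.cexp)).congr_deriv ?_
    ring
  have hc := is_const_of_deriv_eq_zero (fun t => (hd t).differentiableAt)
    (fun t => (hd t).deriv) t s
  simp only [intervalIntegral.integral_same, Complex.ofReal_zero, zero_mul, neg_zero,
    Complex.exp_zero, mul_one] at hc
  rw [← hc, mul_assoc, ← Complex.exp_add, neg_add_cancel, Complex.exp_zero, mul_one]

/-- With $r=1-|a|$ and $\alpha=\arg a$, the kernel is at least $1/(4r)$ on $[\alpha-r,\alpha+r]$,
which gives $2r/(4r)=1/2$. The window lies in $[\theta-\delta,\theta+\delta]$ once $r$ and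
$|\alpha-\theta|$ are below $\delta/2$. -/
theorem eventually_half_le_integral_poissonDensity (θ : ℝ) {δ : ℝ} (hδ : 0 < δ) :
    ∀ᶠ a in 𝓝 (Circle.exp θ : ℂ), a ≠ 0 → ‖a‖ < 1 →
      1 / 2 ≤ ∫ u in (θ - δ)..(θ + δ), poissonDensity a u := by
  have h1 : Tendsto (fun a : ℂ => (a * (Circle.exp (-θ) : ℂ)).arg) (𝓝 (Circle.exp θ : ℂ)) (𝓝 0) := by
    have : ((Circle.exp θ : ℂ) * (Circle.exp (-θ) : ℂ)) = 1 := by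
      rw [← Circle.coe_mul, ← Circle.exp_add]; simp
    have hc : ContinuousAt (fun a : ℂ => (a * (Circle.exp (-θ) : ℂ)).arg) (Circle.exp θ : ℂ) := by
      refine ContinuousAt.comp (g := Complex.arg) ?_ (by fun_prop)
      rw [this]
      exact Complex.continuousAt_arg (by simp)
    have := hc.tendsto
    rwa [‹(Circle.exp θ : ℂ) * _ = 1›, Complex.arg_one] at this
  have h2 : Tendsto (fun a : ℂ => ‖a‖) (𝓝 (Circle.exp θ : ℂ)) (𝓝 1) := by
    simpa using (continuous_norm (E := ℂ)).tendsto (Circle.exp θ : ℂ)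
  filter_upwards [h1.eventually (Ioo_mem_nhds (a := -(δ / 2)) (b := δ / 2) (by linarith)
    (by linarith)), h2.eventually (lt_mem_nhds (a := 1 - δ / 2) (by linarith))] with a ha1 ha2 ha0 ha
  set r := 1 - ‖a‖ with hr
  -- Rotating by $-\theta$ first keeps `Complex.arg` near $0$, away from its branch cut.
  set α := θ + (a * (Circle.exp (-θ) : ℂ)).arg with hα
  have hr0 : 0 < r := by linarith
  have hpol : (a : ℂ) = ‖a‖ * (Circle.exp α : ℂ) := by
    have h3 := Complex.norm_mul_exp_arg_mul_I (a * (Circle.exp (-θ) : ℂ))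
    rw [hα, Circle.exp_add, Circle.coe_mul, Circle.coe_exp (Complex.arg _)]
    rw [norm_mul, Circle.norm_coe, mul_one] at h3
    rw [mul_left_comm, h3, mul_left_comm, ← Circle.coe_mul, ← Circle.exp_add]
    simp
  have hint : ∀ u v, IntervalIntegrable (poissonDensity a) MeasureTheory.volume u v :=
    fun u v => (continuous_poissonDensity ha).intervalIntegrable u v
  have hlow : ∀ u ∈ Set.Icc (α - r) (α + r), 1 / (4 * r) ≤ poissonDensity a u := by
    intro u hu
    have h3 : ‖(Circle.exp u : ℂ) - a‖ ≤ 2 * r := by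
      have h4 : ‖(Circle.exp u : ℂ) - Circle.exp α‖ ≤ |u - α| := by
        have h6 : (Circle.exp u : ℂ) - Circle.exp α =
            Circle.exp α * (Complex.exp (Complex.I * ((u - α : ℝ) : ℂ)) - 1) := by
          have : (Circle.exp u : ℂ) = Circle.exp α * Circle.exp (u - α) := by
            rw [← Circle.coe_mul, ← Circle.exp_add]; congr 2; ring
          rw [this, Circle.coe_exp (u - α), mul_comm Complex.I]; ring
        rw [h6, norm_mul, Circle.norm_coe, one_mul]
        exact Real.norm_exp_I_mul_ofReal_sub_one_le
      have h5 : ‖(Circle.exp α : ℂ) - a‖ = r := by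
        have : (Circle.exp α : ℂ) - a = (r : ℝ) * Circle.exp α := by
          rw [hr, Complex.ofReal_sub, Complex.ofReal_one]
          linear_combination -hpol
        rw [this, norm_mul, Circle.norm_coe, mul_one, Complex.norm_real, Real.norm_of_nonneg hr0.le]
      have h6 : |u - α| ≤ r := abs_le.2 ⟨by linarith [hu.1], by linarith [hu.2]⟩
      calc _ ≤ ‖(Circle.exp u : ℂ) - Circle.exp α‖ + ‖(Circle.exp α : ℂ) - a‖ :=
            norm_sub_le_norm_sub_add_norm_sub _ _ _
        _ ≤ 2 * r := by linarith
    have h4 := norm_pos_iff.2 (circleExp_sub_ne_zero ha u)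
    have h5 : r ≤ 1 - ‖a‖ ^ 2 := by nlinarith [norm_nonneg a]
    calc 1 / (4 * r) = r / (2 * r) ^ 2 := by field_simp; norm_num
      _ ≤ poissonDensity a u := by unfold poissonDensity; gcongr; linarith
  have h3 : ∫ u in (α - r)..(α + r), (1 / (4 * r)) ≤ ∫ u in (α - r)..(α + r), poissonDensity a u :=
    intervalIntegral.integral_mono_on (by linarith) (by simp) (hint _ _) hlow
  have h4 : ∫ u in (α - r)..(α + r), poissonDensity a u ≤
      ∫ u in (θ - δ)..(θ + δ), poissonDensity a u := by
    refine intervalIntegral.integral_mono_interval (by linarith [ha1.1]) (by linarith)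
      (by linarith [ha1.2]) (Eventually.of_forall fun u => (poissonDensity_pos ha u).le) (hint _ _)
  refine le_trans (le_of_eq ?_) (h3.trans h4)
  rw [intervalIntegral.integral_const, smul_eq_mul]
  field_simp
  ring

/-! ### Infinite Blaschke products on the circle -/

/-- The zeros of an infinite Blaschke product, apart from a possible zero at the origin. -/
structure IsBlaschkeSequence (a : ℕ → ℂ) : Prop where
  ne_zero : ∀ j, a j ≠ 0
  norm_lt_one : ∀ j, ‖a j‖ < 1
  summable : Summable fun j => 1 - ‖a j‖

/-- The formula for the Blaschke product, on the whole plane. -/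
noncomputable def blaschkeFormula (c : ℂ) (p : ℕ) (a : ℕ → ℂ) (z : ℂ) : ℂ :=
  c * z ^ p * ∏' j, blaschkeFactor (a j) z

theorem exists_pos_le_norm_sub_of_notMem_closure {a : ℕ → ℂ} {K : Set ℂ} (hK : IsCompact K)
    (h : ∀ z ∈ K, z ∉ closure (Set.range a)) : ∃ δ > 0, ∀ z ∈ K, ∀ j, δ ≤ ‖z - a j‖ := by
  obtain ⟨δ, hδ, hd⟩ := Metric.exists_pos_forall_lt_edist hK isClosed_closure
    (Set.disjoint_left.2 h)
  refine ⟨δ, by exact_mod_cast hδ, fun z hz j => ?_⟩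
  have h1 := hd z hz (a j) (subset_closure ⟨j, rfl⟩)
  rw [edist_nndist, ENNReal.coe_lt_coe] at h1
  rw [← dist_eq_norm]
  exact_mod_cast h1.le

namespace IsBlaschkeSequence

variable {a : ℕ → ℂ} (ha : IsBlaschkeSequence a)
include ha

theorem summable_norm_blaschkeFactor_sub_one {z : ℂ} {δ : ℝ} (hδ : 0 < δ)
    (hz : ∀ j, δ ≤ ‖1 - (starRingEnd ℂ) (a j) * z‖) :
    Summable fun j => ‖blaschkeFactor (a j) z - 1‖ :=
  (ha.summable.mul_left ((1 + ‖z‖) / δ)).of_nonneg_of_le (fun _ => norm_nonneg _) fun j =>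
    norm_blaschkeFactor_sub_one_le hδ (ha.ne_zero j) (ha.norm_lt_one j) (hz j)

theorem multipliable_blaschkeFactor {z : ℂ} {δ : ℝ} (hδ : 0 < δ)
    (hz : ∀ j, δ ≤ ‖1 - (starRingEnd ℂ) (a j) * z‖) :
    Multipliable fun j => blaschkeFactor (a j) z := by
  simpa using multipliable_one_add_of_summable (ha.summable_norm_blaschkeFactor_sub_one hδ hz)

theorem le_norm_one_sub_conj_mul (z : ℂ) (j : ℕ) :
    1 - ‖z‖ ≤ ‖1 - (starRingEnd ℂ) (a j) * z‖ := by
  have h1 : ‖(starRingEnd ℂ) (a j) * z‖ ≤ ‖z‖ := by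
    rw [norm_mul, RCLike.norm_conj]
    exact mul_le_of_le_one_left (norm_nonneg _) (ha.norm_lt_one j).le
  have h2 := norm_sub_norm_le (1 : ℂ) ((starRingEnd ℂ) (a j) * z)
  rw [norm_one] at h2
  linarith

theorem tprod_ne_zero {z : ℂ} (hz : ‖z‖ < 1) (hza : ∀ j, z ≠ a j) :
    ∏' j, blaschkeFactor (a j) z ≠ 0 := by
  have hδ : 0 < 1 - ‖z‖ := by linarith
  have h := tprod_one_add_ne_zero_of_summable (f := fun j => blaschkeFactor (a j) z - 1)
    (fun j => ?_) (ha.summable_norm_blaschkeFactor_sub_one hδ (ha.le_norm_one_sub_conj_mul z))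
  · simpa using h
  · have h1 : 1 - (starRingEnd ℂ) (a j) * z ≠ 0 :=
      norm_pos_iff.1 (hδ.trans_le (ha.le_norm_one_sub_conj_mul z j))
    have h2 := ha.ne_zero j
    have h3 : a j - z ≠ 0 := sub_ne_zero.2 (hza j).symm
    simp [blaschkeFactor, h1, h2, h3]

/-- If $\zeta$ has distance at least $\delta$ from all zeros, the denominators stay at least
$\delta/2$ on the ball of radius $\delta/2$, where the product converges locally uniformly by the
M-test. -/
theorem analyticAt_blaschkeFormula (c : ℂ) (p : ℕ) {ζ : ℂ} (hζ : ‖ζ‖ = 1)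
    (hcl : ζ ∉ closure (Set.range a)) : AnalyticAt ℂ (blaschkeFormula c p a) ζ := by
  obtain ⟨δ, hδ, hd⟩ := exists_pos_le_norm_sub_of_notMem_closure (K := {ζ}) isCompact_singleton
    (by simpa using hcl)
  have hlow : ∀ z ∈ Metric.ball ζ (δ / 2), ∀ j, δ / 2 ≤ ‖1 - (starRingEnd ℂ) (a j) * z‖ := by
    intro z hz j
    have h1 := hd ζ rfl j
    rw [← norm_one_sub_conj_mul hζ] at h1
    have h2 : ‖(starRingEnd ℂ) (a j) * (z - ζ)‖ ≤ δ / 2 := by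
      rw [norm_mul, RCLike.norm_conj]
      rw [Metric.mem_ball, dist_eq_norm] at hz
      exact (mul_le_of_le_one_left (norm_nonneg _) (ha.norm_lt_one j).le).trans hz.le
    have h3 := norm_sub_norm_le (1 - (starRingEnd ℂ) (a j) * ζ) ((starRingEnd ℂ) (a j) * (z - ζ))
    have h4 : 1 - (starRingEnd ℂ) (a j) * ζ - (starRingEnd ℂ) (a j) * (z - ζ) =
      1 - (starRingEnd ℂ) (a j) * z := by ring
    rw [h4] at h3
    linarith
  have hdiff : ∀ j, DifferentiableOn ℂ (blaschkeFactor (a j)) (Metric.ball ζ (δ / 2)) := by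
    intro j
    unfold blaschkeFactor
    refine DifferentiableOn.const_mul (DifferentiableOn.div (by fun_prop) (by fun_prop)
      fun z hz => norm_pos_iff.1 ((half_pos hδ).trans_le (hlow z hz j))) _
  have hprod := Summable.hasProdLocallyUniformlyOn_nat_one_add (K := Metric.ball ζ (δ / 2))
    (f := fun j z => blaschkeFactor (a j) z - 1) Metric.isOpen_ball
    (ha.summable.mul_left ((1 + (1 + δ / 2)) / (δ / 2))) (Eventually.of_forall fun j z hz => ?_)
    (fun j => ((hdiff j).continuousOn.sub continuousOn_const))
  · simp only [add_sub_cancel] at hprod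
    have h := (hasProdLocallyUniformlyOn_iff_tendstoLocallyUniformlyOn.1 hprod).differentiableOn
      (Eventually.of_forall fun s => DifferentiableOn.fun_finsetProd fun j _ => hdiff j)
      Metric.isOpen_ball
    have h' : DifferentiableOn ℂ (blaschkeFormula c p a) (Metric.ball ζ (δ / 2)) := by
      unfold blaschkeFormula
      exact DifferentiableOn.mul (by fun_prop) h
    exact h'.analyticAt (Metric.ball_mem_nhds _ (half_pos hδ))
  · refine (norm_blaschkeFactor_sub_one_le (half_pos hδ) (ha.ne_zero j) (ha.norm_lt_one j)
      (hlow z hz j)).trans ?_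
    have h1 : ‖z‖ ≤ 1 + δ / 2 := by
      rw [Metric.mem_ball, dist_eq_norm] at hz
      have := norm_sub_norm_le z ζ
      linarith
    have := ha.norm_lt_one j
    gcongr

variable {B : ℂ → ℂ} {c : ℂ} {p : ℕ}
  (hB : ∀ z ∈ Metric.ball (0 : ℂ) 1, B z = blaschkeFormula c p a z)
include hB

theorem notMem_boundarySpectrum_of_notMem_closure {ζ : Circle}
    (hcl : (ζ : ℂ) ∉ closure (Set.range a)) : ζ ∉ boundarySpectrum B := fun h =>
  h ⟨_, ha.analyticAt_blaschkeFormula c p (Circle.norm_coe ζ) hcl,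
    eventually_nhdsWithin_of_forall fun z hz => (hB z hz).symm⟩

theorem boundaryValue_eq {ζ : Circle} (hcl : (ζ : ℂ) ∉ closure (Set.range a)) :
    boundaryValue B ζ = blaschkeFormula c p a ζ := by
  have hc := (ha.analyticAt_blaschkeFormula c p (Circle.norm_coe ζ) hcl).continuousAt
  have h1 : Tendsto (fun r : ℝ => (r : ℂ) * (ζ : ℂ)) (𝓝[<] 1) (𝓝 (ζ : ℂ)) := by
    have : Continuous fun r : ℝ => (r : ℂ) * (ζ : ℂ) := by fun_prop
    simpa using (this.tendsto 1).mono_left nhdsWithin_le_nhds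
  refine Tendsto.limUnder_eq ((hc.tendsto.comp h1).congr' ?_)
  filter_upwards [Ioo_mem_nhdsLT (show (0 : ℝ) < 1 by norm_num)] with r hr
  refine (hB _ ?_).symm
  rw [mem_ball_zero_iff, norm_mul, Circle.norm_coe, mul_one, Complex.norm_real,
    Real.norm_of_nonneg hr.1.le]
  exact hr.2

/-- Zeros accumulating at $\zeta$ are zeros of the extension $g$. By the isolation of zeros $g$
would vanish near $\zeta$, but $B$ has only countably many zeros in the disc. -/
theorem notMem_closure_of_notMem_boundarySpectrum (hc : c ≠ 0) {ζ : Circle}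
    (h : ζ ∉ boundarySpectrum B) : (ζ : ℂ) ∉ closure (Set.range a) := by
  intro hcl
  obtain ⟨g, hg, hgB⟩ := not_not.1 h
  have hζ0 : ∀ j, a j ≠ (ζ : ℂ) := fun j hj => by
    have := ha.norm_lt_one j
    rw [hj, Circle.norm_coe] at this
    exact lt_irrefl _ this
  have hzero : ∀ j, B (a j) = 0 := by
    intro j
    have hj : a j ∈ Metric.ball (0 : ℂ) 1 := by simpa using ha.norm_lt_one j
    rw [hB _ hj, blaschkeFormula, tprod_of_exists_eq_zero ⟨j, by simp [blaschkeFactor]⟩, mul_zero]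
  rcases hg.eventually_eq_zero_or_eventually_ne_zero with h0 | h0
  · have h1 : ∀ᶠ z in 𝓝[Metric.ball (0 : ℂ) 1] (ζ : ℂ), B z = 0 := by
      filter_upwards [hgB, nhdsWithin_le_nhds h0] with z hz hz'
      rw [← hz, hz']
    rw [eventually_nhdsWithin_iff, eventually_nhds_iff] at h1
    obtain ⟨U, hU, hUo, hζU⟩ := h1
    have hne : (U ∩ Metric.ball (0 : ℂ) 1).Nonempty := by
      have : (ζ : ℂ) ∈ closure (Metric.ball (0 : ℂ) 1) := by
        rw [closure_ball _ one_ne_zero, mem_closedBall_zero_iff, Circle.norm_coe]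
      exact mem_closure_iff.1 this U hUo hζU
    -- The complement of a countable set is dense, so some point of the open set where $B=0$ is
    -- neither $0$ nor a zero $a_j$.
    have hcount : (insert 0 (Set.range a)).Countable := (Set.countable_range a).insert 0
    obtain ⟨z, hz, hza⟩ := (hcount.dense_compl ℂ).inter_open_nonempty _
      (hUo.inter Metric.isOpen_ball) hne
    simp only [Set.mem_compl_iff, Set.mem_insert_iff, Set.mem_range, not_or, not_exists] at hza
    have h2 := hU z hz.1 hz.2
    rw [hB z hz.2] at h2
    refine mul_ne_zero (mul_ne_zero hc (pow_ne_zero _ hza.1)) (ha.tprod_ne_zero ?_ ?_) h2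
    · simpa using hz.2
    · exact fun j hj => hza.2 j hj.symm
  · rw [eventually_nhdsWithin_iff, eventually_nhds_iff] at h0
    rw [eventually_nhdsWithin_iff, eventually_nhds_iff] at hgB
    obtain ⟨U, hU, hUo, hζU⟩ := h0
    obtain ⟨V, hV, hVo, hζV⟩ := hgB
    obtain ⟨_, hz, j, rfl⟩ := mem_closure_iff.1 hcl _ (hUo.inter hVo) ⟨hζU, hζV⟩
    exact hU _ hz.1 (hζ0 j) ((hV _ hz.2 (by simpa using ha.norm_lt_one j)).trans (hzero j))

omit hB in
-- No $a_j$ lies on the circle, so finitely many of them can be removed from a neighbourhood of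
-- $\zeta$.
theorem infinite_setOf_mem {ζ : Circle} (hcl : (ζ : ℂ) ∈ closure (Set.range a)) {U : Set ℂ}
    (hU : U ∈ 𝓝 (ζ : ℂ)) : {j | a j ∈ U}.Infinite := by
  intro hfin
  have h1 : (a '' {j | a j ∈ U}).Finite := hfin.image a
  have h2 : (ζ : ℂ) ∉ a '' {j | a j ∈ U} := by
    rintro ⟨j, -, hj⟩
    have := ha.norm_lt_one j
    rw [hj, Circle.norm_coe] at this
    exact lt_irrefl _ this
  have h3 : U ∩ (a '' {j | a j ∈ U})ᶜ ∈ 𝓝 (ζ : ℂ) :=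
    inter_mem hU (h1.isClosed.isOpen_compl.mem_nhds h2)
  obtain ⟨_, hz, j, rfl⟩ := mem_closure_iff_nhds.1 hcl _ h3
  exact hz.2 ⟨j, hz.1, rfl⟩

omit hB in
theorem norm_blaschkeFormula_circle (hc : ‖c‖ = 1) {ζ : Circle}
    (hcl : (ζ : ℂ) ∉ closure (Set.range a)) : ‖blaschkeFormula c p a ζ‖ = 1 := by
  obtain ⟨δ, hδ, hd⟩ := exists_pos_le_norm_sub_of_notMem_closure (K := {(ζ : ℂ)})
    isCompact_singleton (by simpa using hcl)
  have h1 : ∀ j, δ ≤ ‖1 - (starRingEnd ℂ) (a j) * ζ‖ := fun j => by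
    rw [norm_one_sub_conj_mul (Circle.norm_coe ζ)]
    exact hd ζ rfl j
  rw [blaschkeFormula, norm_mul, norm_mul, hc, norm_pow, Circle.norm_coe,
    (ha.multipliable_blaschkeFactor hδ h1).norm_tprod]
  simp [norm_blaschkeFactor_circle (ha.ne_zero _) (ha.norm_lt_one _) (Circle.norm_coe ζ)]

omit hB in
theorem norm_integral_poissonDensity_le {u v δ : ℝ} (hδ : 0 < δ)
    (hd : ∀ t ∈ Set.uIcc u v, ∀ j, δ ≤ ‖(Circle.exp t : ℂ) - a j‖) (j : ℕ) :
    ‖∫ t in u..v, poissonDensity (a j) t‖ ≤ 2 / δ ^ 2 * |v - u| * (1 - ‖a j‖) := by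
  refine (intervalIntegral.norm_integral_le_of_norm_le_const
    (C := 2 / δ ^ 2 * (1 - ‖a j‖)) fun t ht => ?_).trans (le_of_eq (by ring))
  rw [Real.norm_of_nonneg (poissonDensity_pos (ha.norm_lt_one j) t).le]
  exact poissonDensity_le (ha.norm_lt_one j) hδ (hd t (Set.uIoc_subset_uIcc ht) j)

omit ha hB in
theorem exists_pos_le_norm_circleExp_sub {s t : ℝ}
    (hreg : ∀ u ∈ Set.Ioo s t, (Circle.exp u : ℂ) ∉ closure (Set.range a)) {u v : ℝ}
    (hu : u ∈ Set.Ioo s t) (hv : v ∈ Set.Ioo s t) :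
    ∃ δ > 0, ∀ w ∈ Set.uIcc u v, ∀ j, δ ≤ ‖(Circle.exp w : ℂ) - a j‖ := by
  obtain ⟨δ, hδ, hd⟩ := exists_pos_le_norm_sub_of_notMem_closure (a := a)
    ((isCompact_uIcc (a := u) (b := v)).image continuous_coe_circleExp) (by
      rintro _ ⟨w, hw, rfl⟩
      exact hreg w (Set.ordConnected_Ioo.uIcc_subset hu hv hw))
  exact ⟨δ, hδ, fun w hw => hd _ ⟨w, hw, rfl⟩⟩

omit hB in
theorem summable_integral_poissonDensity {s t : ℝ}
    (hreg : ∀ u ∈ Set.Ioo s t, (Circle.exp u : ℂ) ∉ closure (Set.range a)) {u v : ℝ}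
    (hu : u ∈ Set.Ioo s t) (hv : v ∈ Set.Ioo s t) :
    Summable fun j => ∫ w in u..v, poissonDensity (a j) w := by
  obtain ⟨δ, hδ, hd⟩ := exists_pos_le_norm_circleExp_sub hreg hu hv
  exact Summable.of_norm_bounded (ha.summable.mul_left _)
    (ha.norm_integral_poissonDensity_le hδ hd)

omit hB in
theorem integral_poissonDensity_add (j : ℕ) (u v w : ℝ) :
    (∫ x in u..v, poissonDensity (a j) x) + ∫ x in v..w, poissonDensity (a j) x =
      ∫ x in u..w, poissonDensity (a j) x :=
  intervalIntegral.integral_add_adjacent_intervals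
    ((continuous_poissonDensity (ha.norm_lt_one j)).intervalIntegrable _ _)
    ((continuous_poissonDensity (ha.norm_lt_one j)).intervalIntegrable _ _)

/-- On an arc without singularities a Blaschke product has a continuous, strictly increasing
argument. -/
theorem exists_argument (hc : ‖c‖ = 1) {s t : ℝ} (hst : s < t)
    (hreg : ∀ u ∈ Set.Ioo s t, (Circle.exp u : ℂ) ∉ closure (Set.range a)) :
    ∃ ψ : ℝ → ℝ, ContinuousOn ψ (Set.Ioo s t) ∧ StrictMonoOn ψ (Set.Ioo s t) ∧
      (∀ u ∈ Set.Ioo s t, boundaryValue B (Circle.exp u) = Complex.exp (ψ u * Complex.I)) ∧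
      ∀ u ∈ Set.Ioo s t, ∀ v ∈ Set.Ioo s t, u ≤ v → ∀ S : Finset ℕ,
        ∑ j ∈ S, ∫ w in u..v, poissonDensity (a j) w ≤ ψ v - ψ u := by
  obtain ⟨m, hm⟩ : (Set.Ioo s t).Nonempty := Set.nonempty_Ioo.2 hst
  set φ : ℕ → ℝ → ℝ := fun j u => ∫ w in m..u, poissonDensity (a j) w with hφ
  have hsum : ∀ u ∈ Set.Ioo s t, Summable fun j => φ j u := fun u hu =>
    ha.summable_integral_poissonDensity hreg hm hu
  set E₀ : ℂ := blaschkeFormula c p a (Circle.exp m) with hE₀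
  -- The argument of $B$ at the base point $m$, then the increments due to $z^p$ and to the Blaschke
  -- factors.
  set ψ : ℝ → ℝ := fun u => E₀.arg + p * (u - m) + ∑' j, φ j u with hψ
  have hint : ∀ j u v, φ j v - φ j u = ∫ w in u..v, poissonDensity (a j) w := by
    intro j u v
    have := ha.integral_poissonDensity_add j m u v
    simp only [hφ]
    linarith
  have hinc : ∀ u ∈ Set.Ioo s t, ∀ v ∈ Set.Ioo s t, u ≤ v → ∀ S : Finset ℕ,
      ∑ j ∈ S, ∫ w in u..v, poissonDensity (a j) w ≤ ψ v - ψ u := by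
    intro u hu v hv huv S
    have h1 : ψ v - ψ u = p * (v - u) + ∑' j, ∫ w in u..v, poissonDensity (a j) w := by
      simp only [← hint]
      rw [(hsum v hv).tsum_sub (hsum u hu)]
      simp only [hψ]
      ring
    have h2 : 0 ≤ (p : ℝ) * (v - u) := mul_nonneg p.cast_nonneg (by linarith)
    have h3 := (ha.summable_integral_poissonDensity hreg hu hv).sum_le_tsum S fun j _ =>
      intervalIntegral.integral_nonneg huv fun w _ => (poissonDensity_pos (ha.norm_lt_one j) w).le
    linarith
  refine ⟨ψ, ?_, ?_, ?_, hinc⟩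
  · intro u hu
    -- Continuity at $u$ is obtained on a compact $[x,y]$ containing both $u$ and $m$, where the
    -- series is dominated by a multiple of $\sum(1-|a_j|)$.
    obtain ⟨x, hx⟩ := exists_between (lt_min hm.1 hu.1)
    obtain ⟨y, hy⟩ := exists_between (max_lt hm.2 hu.2)
    rw [lt_min_iff] at hx
    rw [max_lt_iff] at hy
    have hxI : x ∈ Set.Ioo s t := ⟨hx.1, hx.2.1.trans hm.2⟩
    have hyI : y ∈ Set.Ioo s t := ⟨hm.1.trans hy.1.1, hy.2⟩
    obtain ⟨δ, hδ, hd⟩ := exists_pos_le_norm_circleExp_sub hreg hxI hyI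
    have hxy : x ≤ y := (hx.2.1.trans hy.1.1).le
    rw [Set.uIcc_of_le hxy] at hd
    have hmxy : m ∈ Set.Icc x y := ⟨hx.2.1.le, hy.1.1.le⟩
    have hcont : ContinuousOn (fun u => ∑' j, φ j u) (Set.Icc x y) := by
      refine continuousOn_tsum (fun j => ?_)
        (ha.summable.mul_left (2 / δ ^ 2 * (y - x))) fun j u hu => ?_
      · have h1 : Continuous (φ j) := intervalIntegral.continuous_primitive
          (fun _ _ => (continuous_poissonDensity (ha.norm_lt_one j)).intervalIntegrable _ _) m
        exact h1.continuousOn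
      · refine (ha.norm_integral_poissonDensity_le hδ (fun w hw => hd w
          (Set.ordConnected_Icc.uIcc_subset hmxy hu hw)) j).trans ?_
        have h1 : |u - m| ≤ y - x :=
          abs_le.2 ⟨by linarith [hu.1, hmxy.2], by linarith [hu.2, hmxy.1]⟩
        have := ha.norm_lt_one j
        gcongr
    have h2 := hcont.continuousAt (Icc_mem_nhds hx.2.2 hy.1.2)
    have h3 : ContinuousAt (fun u : ℝ => E₀.arg + p * (u - m)) u := by fun_prop
    exact (h3.add h2).continuousWithinAt
  · intro u hu v hv huv
    -- One zero suffices for strictness; the power $z^p$ may be absent.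
    have h1 := hinc u hu v hv huv.le {0}
    rw [Finset.sum_singleton] at h1
    have h2 : 0 < ∫ w in u..v, poissonDensity (a 0) w :=
      intervalIntegral.intervalIntegral_pos_of_pos
        ((continuous_poissonDensity (ha.norm_lt_one 0)).intervalIntegrable _ _)
        (poissonDensity_pos (ha.norm_lt_one 0)) huv
    linarith
  · intro u hu
    have hmult : Multipliable fun j => blaschkeFactor (a j) (Circle.exp m) := by
      obtain ⟨δ, hδ, hd⟩ := exists_pos_le_norm_circleExp_sub hreg hm hm
      refine ha.multipliable_blaschkeFactor hδ fun j => ?_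
      rw [norm_one_sub_conj_mul (Circle.norm_coe _)]
      exact hd m (by simp) j
    have hexp : HasProd (fun j => Complex.exp ((φ j u : ℝ) * Complex.I))
        (Complex.exp ((∑' j, φ j u : ℝ) * Complex.I)) :=
      ((Complex.hasSum_ofReal.2 (hsum u hu).hasSum).mul_right Complex.I).cexp
    have hprod : ∏' j, blaschkeFactor (a j) (Circle.exp u) =
        (∏' j, blaschkeFactor (a j) (Circle.exp m)) *
          Complex.exp ((∑' j, φ j u : ℝ) * Complex.I) := by
      rw [← (hmult.hasProd.mul hexp).tprod_eq]
      exact tprod_congr fun j => blaschkeFactor_circleExp (ha.norm_lt_one j) m u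
    have hE : E₀ = Complex.exp (E₀.arg * Complex.I) := by
      have h1 := Complex.norm_mul_exp_arg_mul_I E₀
      rw [hE₀, ha.norm_blaschkeFormula_circle hc (hreg m hm), Complex.ofReal_one, one_mul] at h1
      exact h1.symm
    have hpow : (Circle.exp u : ℂ) ^ p =
        (Circle.exp m : ℂ) ^ p * Complex.exp ((p * (u - m) : ℝ) * Complex.I) := by
      simp only [Circle.coe_exp, ← Complex.exp_nat_mul, ← Complex.exp_add]
      congr 1
      push_cast
      ring
    have hψu : Complex.exp (ψ u * Complex.I) = Complex.exp (E₀.arg * Complex.I) *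
        Complex.exp ((p * (u - m) : ℝ) * Complex.I) *
          Complex.exp ((∑' j, φ j u : ℝ) * Complex.I) := by
      rw [← Complex.exp_add, ← Complex.exp_add]
      congr 1
      simp only [hψ]
      push_cast
      ring
    rw [ha.boundaryValue_eq hB (hreg u hu), blaschkeFormula, hprod, hpow, hψu, ← hE, hE₀,
      blaschkeFormula]
    ring

omit hB in
/-- At an accumulation point of the zeros, the argument is unbounded on at least one side. -/
theorem not_bddAbove_or_not_bddBelow {r s t u : ℝ} (hrs : r < s) (htu : t < u)
    (hst : (Circle.exp s : ℂ) = Circle.exp t)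
    (hsing : (Circle.exp t : ℂ) ∈ closure (Set.range a)) {ψ χ : ℝ → ℝ}
    (hψ : ∀ x ∈ Set.Ioo r s, ∀ y ∈ Set.Ioo r s, x ≤ y → ∀ S : Finset ℕ,
      ∑ j ∈ S, ∫ w in x..y, poissonDensity (a j) w ≤ ψ y - ψ x)
    (hχ : ∀ x ∈ Set.Ioo t u, ∀ y ∈ Set.Ioo t u, x ≤ y → ∀ S : Finset ℕ,
      ∑ j ∈ S, ∫ w in x..y, poissonDensity (a j) w ≤ χ y - χ x) :
    ¬ BddAbove (ψ '' Set.Ioo r s) ∨ ¬ BddBelow (χ '' Set.Ioo t u) := by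
  by_contra! hcon
  obtain ⟨⟨M, hM⟩, ⟨m, hm⟩⟩ := hcon
  obtain ⟨δ, hδ, hδ'⟩ := exists_between (lt_min (sub_pos.2 hrs) (sub_pos.2 htu))
  rw [lt_min_iff] at hδ'
  have hcont : ∀ (S : Finset ℕ) (x : ℝ),
      Continuous fun y => ∑ j ∈ S, ∫ w in x..y, poissonDensity (a j) w := fun S x =>
    continuous_finsetSum _ fun j _ => intervalIntegral.continuous_primitive
      (fun _ _ => (continuous_poissonDensity (ha.norm_lt_one j)).intervalIntegrable _ _) x
  -- A finite sum of kernels is continuous up to the singular point, so the bound on $\psi$ passes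
  -- to the limit with a constant independent of $S$.
  have hleft : ∀ S : Finset ℕ, ∑ j ∈ S, ∫ w in (s - δ)..s, poissonDensity (a j) w ≤
      M - ψ (s - δ) := by
    intro S
    refine le_of_tendsto ((hcont S (s - δ)).tendsto s |>.mono_left
      (nhdsWithin_le_nhds (s := Set.Iio s))) ?_
    filter_upwards [Ioo_mem_nhdsLT (show s - δ < s by linarith)] with y hy
    have hy' : y ∈ Set.Ioo r s := ⟨by linarith [hy.1], hy.2⟩
    have h1 := hψ (s - δ) ⟨by linarith, by linarith⟩ y hy' hy.1.le S
    have h2 := hM ⟨y, hy', rfl⟩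
    linarith
  have hright : ∀ S : Finset ℕ, ∑ j ∈ S, ∫ w in t..(t + δ), poissonDensity (a j) w ≤
      χ (t + δ) - m := by
    intro S
    have h0 : ∀ x, ∑ j ∈ S, ∫ w in x..(t + δ), poissonDensity (a j) w =
        -∑ j ∈ S, ∫ w in (t + δ)..x, poissonDensity (a j) w := fun x => by
      rw [← Finset.sum_neg_distrib]
      exact Finset.sum_congr rfl fun j _ => intervalIntegral.integral_symm _ _
    have hc : Continuous fun x => ∑ j ∈ S, ∫ w in x..(t + δ), poissonDensity (a j) w := by
      simp only [h0]
      exact (hcont S (t + δ)).neg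
    refine le_of_tendsto (hc.tendsto t |>.mono_left (nhdsWithin_le_nhds (s := Set.Ioi t))) ?_
    filter_upwards [Ioo_mem_nhdsGT (show t < t + δ by linarith)] with x hx
    have hx' : x ∈ Set.Ioo t u := ⟨hx.1, by linarith [hx.2]⟩
    have h1 := hχ x hx' (t + δ) ⟨by linarith, by linarith⟩ hx.2.le S
    have h2 := hm ⟨x, hx', rfl⟩
    linarith
  -- The parameters $s$ and $t$ differ by a multiple of $2\pi$; periodicity makes the two integrals
  -- adjacent.
  have hshift : ∀ j, ∫ w in (s - δ)..s, poissonDensity (a j) w =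
      ∫ w in (t - δ)..t, poissonDensity (a j) w := by
    intro j
    obtain ⟨n, hn⟩ := Circle.exp_eq_exp.1 (Circle.coe_injective hst.symm)
    have hper : ∀ x, poissonDensity (a j) (x + n * (2 * Real.pi)) = poissonDensity (a j) x :=
      fun x => (poissonDensity_periodic (a j)).int_mul n x
    rw [← intervalIntegral.integral_congr (fun x _ => hper x),
      intervalIntegral.integral_comp_add_right, ← hn]
    congr 1
    linarith
  have htot : ∀ S : Finset ℕ, ∑ j ∈ S, ∫ w in (t - δ)..(t + δ), poissonDensity (a j) w ≤
      M - ψ (s - δ) + (χ (t + δ) - m) := by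
    intro S
    simp only [← ha.integral_poissonDensity_add _ (t - δ) t (t + δ), Finset.sum_add_distrib]
    refine add_le_add ?_ (hright S)
    simp only [← hshift]
    exact hleft S
  have hinf := ha.infinite_setOf_mem (ζ := Circle.exp t) hsing
    (eventually_half_le_integral_poissonDensity t hδ)
  -- More than twice the bound many zeros, at $1/2$ each, exceed the bound.
  obtain ⟨N, hN⟩ := exists_nat_gt (2 * (M - ψ (s - δ) + (χ (t + δ) - m)))
  obtain ⟨S, hS, hcard⟩ := hinf.exists_subset_card_eq N
  have h1 := S.card_nsmul_le_sum (fun j => ∫ w in (t - δ)..(t + δ), poissonDensity (a j) w) (1 / 2)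
    fun j hj => hS hj (ha.ne_zero j) (ha.norm_lt_one j)
  rw [hcard, nsmul_eq_mul] at h1
  linarith [htot S]

end IsBlaschkeSequence

/-! ### Arcs with a continuous increasing argument -/

theorem derivedSet_subset_of_finite_diff {X : Type*} [TopologicalSpace X] [T1Space X] {A C : Set X}
    (h : (A \ C).Finite) (hC : IsClosed C) : derivedSet A ⊆ C := by
  intro z hz
  by_contra hzC
  rw [mem_derivedSet, accPt_iff_nhds] at hz
  obtain ⟨y, hy, hyz⟩ := hz (Cᶜ ∩ ((A \ C) \ {z})ᶜ) (inter_mem (hC.isOpen_compl.mem_nhds hzC)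
    ((h.subset Set.sdiff_subset).isClosed.isOpen_compl.mem_nhds (by simp)))
  exact hy.1.2 ⟨⟨hy.2, hy.1.1⟩, hyz⟩

/-- `ψ` is a continuous strictly increasing argument of the boundary values of `B` on the arc from
`e ^ (i s)` to `e ^ (i t)`. -/
structure IsArgumentOn (B : ℂ → ℂ) (s t : ℝ) (ψ : ℝ → ℝ) : Prop where
  lt : s < t
  lt_add : t < s + 2 * Real.pi
  continuousOn : ContinuousOn ψ (Set.Ioo s t)
  strictMonoOn : StrictMonoOn ψ (Set.Ioo s t)
  boundaryValue_eq : ∀ u ∈ Set.Ioo s t,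
    boundaryValue B (Circle.exp u) = Complex.exp (ψ u * Complex.I)

namespace IsArgumentOn

variable {B : ℂ → ℂ} {s t : ℝ} {ψ : ℝ → ℝ} (h : IsArgumentOn B s t ψ)
include h

theorem injOn : Set.InjOn Circle.exp (Set.Icc s t) :=
  Circle.exp_injOn_Icc (by linarith [h.lt_add])

theorem exp_ne : Circle.exp s ≠ Circle.exp t := fun he =>
  h.lt.ne (h.injOn (Set.left_mem_Icc.2 h.lt.le) (Set.right_mem_Icc.2 h.lt.le) he)

theorem boundaryValue_eq_one_iff {u : ℝ} (hu : u ∈ Set.Ioo s t) :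
    boundaryValue B (Circle.exp u) = 1 ↔ ∃ n : ℤ, ψ u = n * (2 * Real.pi) := by
  rw [h.boundaryValue_eq u hu, Complex.exp_eq_one_iff]
  refine exists_congr fun n => ?_
  rw [← mul_assoc, mul_left_inj' Complex.I_ne_zero]
  exact_mod_cast Iff.rfl

/-- A bounded interval contains finitely many multiples of $2\pi$, and $\psi$ takes each of them at
most once. -/
theorem finite_solutions {P : Set ℝ} {x y : ℝ} (hP : ∀ u ∈ P, x ≤ ψ u ∧ ψ u ≤ y) :
    {ζ | ∃ u ∈ Set.Ioo s t ∩ P, Circle.exp u = ζ ∧ boundaryValue B ζ = 1}.Finite := by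
  have h1 : {u | u ∈ Set.Ioo s t ∩ P ∧ ∃ n : ℤ, ψ u = n * (2 * Real.pi)}.Finite := by
    refine Set.Finite.of_finite_image (f := ψ) ?_ (h.strictMonoOn.injOn.mono fun u hu => hu.1.1)
    refine ((Set.finite_Icc ⌈x / (2 * Real.pi)⌉ ⌊y / (2 * Real.pi)⌋).image
      fun n : ℤ => (n : ℝ) * (2 * Real.pi)).subset ?_
    rintro _ ⟨u, ⟨hu, n, hn⟩, rfl⟩
    have := hP u hu.2
    rw [hn] at this
    refine ⟨n, ⟨Int.ceil_le.2 ?_, Int.le_floor.2 ?_⟩, hn.symm⟩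
    · rw [div_le_iff₀ Real.two_pi_pos]; exact this.1
    · rw [le_div_iff₀ Real.two_pi_pos]; exact this.2
  refine (h1.image Circle.exp).subset ?_
  rintro ζ ⟨u, hu, rfl, hv⟩
  exact ⟨u, ⟨hu, (h.boundaryValue_eq_one_iff hu.1).1 hv⟩, rfl⟩

/-- The part $P$, where $\psi$ is bounded, carries only finitely many solutions; accumulation must
come from the rest, which $C$ covers. -/
theorem derivedSet_subset {P C : Set ℝ} {x y : ℝ} (hC : IsCompact C)
    (hP : ∀ u ∈ P, x ≤ ψ u ∧ ψ u ≤ y) (hPC : ∀ u ∈ Set.Ioo s t, u ∈ P ∨ u ∈ C) :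
    derivedSet (arcSolutions B s t) ⊆ Circle.exp '' C := by
  refine derivedSet_subset_of_finite_diff ((h.finite_solutions hP).subset ?_)
    (hC.image Circle.exp.continuous).isClosed
  rintro ζ ⟨⟨⟨u, hu, rfl⟩, hv⟩, hn⟩
  rcases hPC u hu with h1 | h1
  · exact ⟨u, ⟨hu, h1⟩, rfl, hv⟩
  · exact absurd ⟨u, h1, rfl⟩ hn

theorem derivedSet_subset_endpoints {x y : ℝ} (hx : x ∈ Set.Ioo s t) (hy : y ∈ Set.Ioo s t) :
    derivedSet (arcSolutions B s t) ⊆ Circle.exp '' (Set.Icc s x ∪ Set.Icc y t) := by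
  refine h.derivedSet_subset (P := Set.Ioo s t ∩ Set.Icc x y) (isCompact_Icc.union isCompact_Icc)
    (fun u hu => ⟨h.strictMonoOn.monotoneOn hx hu.1 hu.2.1,
      h.strictMonoOn.monotoneOn hu.1 hy hu.2.2⟩) fun u hu => ?_
  rcases le_or_gt u x with h1 | h1
  · exact Or.inr (Or.inl ⟨hu.1.le, h1⟩)
  rcases le_or_gt y u with h2 | h2
  · exact Or.inr (Or.inr ⟨h2, hu.2.le⟩)
  · exact Or.inl ⟨hu, h1.le, h2.le⟩

theorem derivedSet_subset_of_bddBelow (hb : BddBelow (ψ '' Set.Ioo s t)) {y : ℝ}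
    (hy : y ∈ Set.Ioo s t) : derivedSet (arcSolutions B s t) ⊆ Circle.exp '' Set.Icc y t := by
  obtain ⟨m, hm⟩ := hb
  refine h.derivedSet_subset (P := Set.Ioo s t ∩ Set.Iic y) isCompact_Icc
    (fun u hu => ⟨hm ⟨u, hu.1, rfl⟩, h.strictMonoOn.monotoneOn hu.1 hy hu.2⟩) fun u hu => ?_
  rcases le_or_gt u y with h1 | h1
  · exact Or.inl ⟨hu, h1⟩
  · exact Or.inr ⟨h1.le, hu.2.le⟩

theorem derivedSet_subset_of_bddAbove (hb : BddAbove (ψ '' Set.Ioo s t)) {x : ℝ}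
    (hx : x ∈ Set.Ioo s t) : derivedSet (arcSolutions B s t) ⊆ Circle.exp '' Set.Icc s x := by
  obtain ⟨m, hm⟩ := hb
  refine h.derivedSet_subset (P := Set.Ioo s t ∩ Set.Ici x) isCompact_Icc
    (fun u hu => ⟨h.strictMonoOn.monotoneOn hx hu.1 hu.2, hm ⟨u, hu.1, rfl⟩⟩) fun u hu => ?_
  rcases le_or_gt x u with h1 | h1
  · exact Or.inl ⟨hu, h1⟩
  · exact Or.inr ⟨hu.1.le, h1.le⟩

theorem exists_solution {u v : ℝ} (hu : u ∈ Set.Ioo s t) (hv : v ∈ Set.Ioo s t)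
    (hd : ψ u + 2 * Real.pi ≤ ψ v) : ∃ w ∈ Set.Icc u v, Circle.exp w ∈ arcSolutions B s t := by
  have huv : u ≤ v := (h.strictMonoOn.le_iff_le hu hv).1 (by linarith [Real.two_pi_pos])
  have hsub : Set.Icc u v ⊆ Set.Ioo s t := Set.ordConnected_Ioo.out hu hv
  -- The first multiple of $2\pi$ from $\psi(u)$ on is below $\psi(u)+2\pi$.
  have h1 : (⌈ψ u / (2 * Real.pi)⌉ : ℝ) * (2 * Real.pi) ∈ Set.Icc (ψ u) (ψ v) := by
    have h2 := Int.le_ceil (ψ u / (2 * Real.pi))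
    have h3 := Int.ceil_lt_add_one (ψ u / (2 * Real.pi))
    rw [div_le_iff₀ Real.two_pi_pos] at h2
    rw [← sub_lt_iff_lt_add, lt_div_iff₀ Real.two_pi_pos] at h3
    exact ⟨h2, by linarith⟩
  obtain ⟨w, hw, hw'⟩ := intermediate_value_Icc huv (h.continuousOn.mono hsub) h1
  exact ⟨w, hw, ⟨w, hsub hw, rfl⟩, (h.boundaryValue_eq_one_iff (hsub hw)).2 ⟨_, hw'⟩⟩

/-- Arbitrarily close to $s$ the argument still varies by $2\pi$, hence passes a solution. -/
theorem mem_derivedSet_left (hb : ¬ BddBelow (ψ '' Set.Ioo s t)) :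
    Circle.exp s ∈ derivedSet (arcSolutions B s t) := by
  rw [mem_derivedSet, accPt_iff_nhds]
  intro U hU
  have h1 : Circle.exp ⁻¹' U ∈ 𝓝[>] s :=
    nhdsWithin_le_nhds (Circle.exp.continuous.continuousAt.preimage_mem_nhds hU)
  obtain ⟨x, hx, hxU⟩ := (mem_nhdsGT_iff_exists_Ioo_subset' h.lt).1 h1
  obtain ⟨v, hv⟩ := exists_between (lt_min hx h.lt)
  rw [lt_min_iff] at hv
  have hvI : v ∈ Set.Ioo s t := ⟨hv.1, hv.2.2⟩
  obtain ⟨_, ⟨u, hu, rfl⟩, huv⟩ := not_bddBelow_iff.1 hb (ψ v - 2 * Real.pi)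
  obtain ⟨w, hw, hw'⟩ := h.exists_solution hu hvI (by linarith)
  have hsw : s < w := hu.1.trans_le hw.1
  refine ⟨_, ⟨hxU ⟨hsw, hw.2.trans_lt hv.2.1⟩, hw'⟩, fun he => hsw.ne' ?_⟩
  exact h.injOn ⟨hsw.le, hw.2.trans hvI.2.le⟩ (Set.left_mem_Icc.2 h.lt.le) he

theorem mem_derivedSet_right (hb : ¬ BddAbove (ψ '' Set.Ioo s t)) :
    Circle.exp t ∈ derivedSet (arcSolutions B s t) := by
  rw [mem_derivedSet, accPt_iff_nhds]
  intro U hU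
  have h1 : Circle.exp ⁻¹' U ∈ 𝓝[<] t :=
    nhdsWithin_le_nhds (Circle.exp.continuous.continuousAt.preimage_mem_nhds hU)
  obtain ⟨x, hx, hxU⟩ := (mem_nhdsLT_iff_exists_Ioo_subset' h.lt).1 h1
  obtain ⟨v, hv⟩ := exists_between (max_lt hx h.lt)
  rw [max_lt_iff] at hv
  have hvI : v ∈ Set.Ioo s t := ⟨hv.1.2, hv.2⟩
  obtain ⟨_, ⟨u, hu, rfl⟩, huv⟩ := not_bddAbove_iff.1 hb (ψ v + 2 * Real.pi)
  obtain ⟨w, hw, hw'⟩ := h.exists_solution hvI hu huv.le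
  have hwt : w < t := hw.2.trans_lt hu.2
  refine ⟨_, ⟨hxU ⟨hv.1.1.trans_le hw.1, hwt⟩, hw'⟩, fun he => hwt.ne ?_⟩
  exact h.injOn ⟨hvI.1.le.trans hw.1, hwt.le⟩ (Set.right_mem_Icc.2 h.lt.le) he

theorem mem_derivedSet_iff {z : Circle} : z ∈ derivedSet (arcSolutions B s t) ↔
    z = Circle.exp s ∧ ¬ BddBelow (ψ '' Set.Ioo s t) ∨
      z = Circle.exp t ∧ ¬ BddAbove (ψ '' Set.Ioo s t) := by
  constructor
  · intro hz
    obtain ⟨m, hm⟩ := Set.nonempty_Ioo.2 h.lt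
    obtain ⟨w, hw, rfl⟩ := h.derivedSet_subset_endpoints hm hm hz
    rw [Set.Icc_union_Icc_eq_Icc hm.1.le hm.2.le] at hw
    have hmem : ∀ C ⊆ Set.Icc s t, Circle.exp w ∈ Circle.exp '' C → w ∈ C := by
      rintro C hC ⟨v, hv, he⟩
      rwa [← h.injOn (hC hv) hw he]
    rcases hw.1.eq_or_lt with rfl | hsw
    · refine Or.inl ⟨rfl, fun hb => ?_⟩
      have := hmem _ (Set.Icc_subset_Icc_left hm.1.le) (h.derivedSet_subset_of_bddBelow hb hm hz)
      exact hm.1.not_ge this.1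
    rcases hw.2.eq_or_lt with rfl | hwt
    · refine Or.inr ⟨rfl, fun hb => ?_⟩
      have := hmem _ (Set.Icc_subset_Icc_right hm.2.le) (h.derivedSet_subset_of_bddAbove hb hm hz)
      exact hm.2.not_ge this.2
    -- For interior $w$, choose $x<w<y$: the solutions in $[x,y]$ are finite in number.
    · exfalso
      obtain ⟨x, hx⟩ := exists_between hsw
      obtain ⟨y, hy⟩ := exists_between hwt
      have := hmem _ (Set.union_subset (Set.Icc_subset_Icc_right (hx.2.trans hwt).le)
        (Set.Icc_subset_Icc_left (hsw.trans hy.1).le)) (h.derivedSet_subset_endpoints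
          ⟨hx.1, hx.2.trans hwt⟩ ⟨hsw.trans hy.1, hy.2⟩ hz)
      rcases this with h1 | h1
      · exact hx.2.not_ge h1.2
      · exact hy.1.not_ge h1.1
  · rintro (⟨rfl, hb⟩ | ⟨rfl, hb⟩)
    · exact h.mem_derivedSet_left hb
    · exact h.mem_derivedSet_right hb

omit h in
theorem infinite_of_mem_derivedSet {A : Set Circle} {z : Circle} (hz : z ∈ derivedSet A) :
    A.Infinite := fun hf =>
  derivedSet_subset_of_finite_diff (hf.subset Set.sdiff_subset) isClosed_empty hz

theorem isArcType2_iff : IsArcType2 B s t ↔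
    ¬ BddBelow (ψ '' Set.Ioo s t) ∧ ¬ BddAbove (ψ '' Set.Ioo s t) := by
  constructor
  · rintro ⟨-, hd⟩
    have h1 : Circle.exp s ∈ derivedSet (arcSolutions B s t) := by simp [hd]
    have h2 : Circle.exp t ∈ derivedSet (arcSolutions B s t) := by simp [hd]
    rw [h.mem_derivedSet_iff] at h1 h2
    simp only [h.exp_ne, h.exp_ne.symm, false_and, or_false, false_or, true_and] at h1 h2
    exact ⟨h1, h2⟩
  · rintro ⟨h1, h2⟩
    refine ⟨infinite_of_mem_derivedSet (h.mem_derivedSet_left h1), ?_⟩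
    ext z
    simp [h.mem_derivedSet_iff, h1, h2]

theorem isArcType1a (h1 : ¬ BddBelow (ψ '' Set.Ioo s t)) (h2 : BddAbove (ψ '' Set.Ioo s t)) :
    IsArcType1a B s t := by
  refine ⟨infinite_of_mem_derivedSet (h.mem_derivedSet_left h1), ?_⟩
  ext z
  simp [h.mem_derivedSet_iff, h1, h2]

theorem isArcType1b (h1 : BddBelow (ψ '' Set.Ioo s t)) (h2 : ¬ BddAbove (ψ '' Set.Ioo s t)) :
    IsArcType1b B s t := by
  refine ⟨infinite_of_mem_derivedSet (h.mem_derivedSet_right h2), ?_⟩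
  ext z
  simp [h.mem_derivedSet_iff, h1, h2]

theorem isArcType0 (h1 : BddBelow (ψ '' Set.Ioo s t)) (h2 : BddAbove (ψ '' Set.Ioo s t)) :
    IsArcType0 B s t := by
  obtain ⟨m, hm⟩ := h1
  obtain ⟨M, hM⟩ := h2
  refine (h.finite_solutions (P := Set.Ioo s t) (x := m) (y := M)
    fun u hu => ⟨hm ⟨u, hu, rfl⟩, hM ⟨u, hu, rfl⟩⟩).subset ?_
  rintro ζ ⟨⟨u, hu, rfl⟩, hv⟩
  exact ⟨u, ⟨hu, hu⟩, rfl, hv⟩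

theorem isArcType : IsArcType0 B s t ∨ IsArcType1a B s t ∨ IsArcType1b B s t ∨
    IsArcType2 B s t := by
  by_cases h1 : BddBelow (ψ '' Set.Ioo s t) <;> by_cases h2 : BddAbove (ψ '' Set.Ioo s t)
  · exact Or.inl (h.isArcType0 h1 h2)
  · exact Or.inr (Or.inr (Or.inl (h.isArcType1b h1 h2)))
  · exact Or.inr (Or.inl (h.isArcType1a h1 h2))
  · exact Or.inr (Or.inr (Or.inr (h.isArcType2_iff.2 ⟨h1, h2⟩)))

/-! ### The range of the argument is an open interval; limits at its finite ends -/

theorem isPreconnected_image : IsPreconnected (ψ '' Set.Ioo s t) :=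
  isPreconnected_Ioo.image _ h.continuousOn

theorem isOpen_image : IsOpen (ψ '' Set.Ioo s t) := by
  rw [isOpen_iff_mem_nhds]
  rintro _ ⟨u, hu, rfl⟩
  obtain ⟨x, hx⟩ := exists_between hu.1
  obtain ⟨y, hy⟩ := exists_between hu.2
  have hxI : x ∈ Set.Ioo s t := ⟨hx.1, hx.2.trans hu.2⟩
  have hyI : y ∈ Set.Ioo s t := ⟨hu.1.trans hy.1, hy.2⟩
  refine mem_of_superset (Icc_mem_nhds (h.strictMonoOn hxI hu hx.2) (h.strictMonoOn hu hyI hy.1))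
    (h.isPreconnected_image.Icc_subset ⟨x, hxI, rfl⟩ ⟨y, hyI, rfl⟩)

theorem image_eq_univ (h1 : ¬ BddBelow (ψ '' Set.Ioo s t)) (h2 : ¬ BddAbove (ψ '' Set.Ioo s t)) :
    ψ '' Set.Ioo s t = Set.univ :=
  h.isPreconnected_image.eq_univ_of_unbounded h1 h2

theorem image_eq_Iio (h1 : ¬ BddBelow (ψ '' Set.Ioo s t)) (h2 : BddAbove (ψ '' Set.Ioo s t)) :
    ψ '' Set.Ioo s t = Set.Iio (sSup (ψ '' Set.Ioo s t)) := by
  refine (Set.Subset.antisymm ?_ (h.isPreconnected_image.Iio_csSup_subset h1 h2))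
  rintro _ ⟨u, hu, rfl⟩
  obtain ⟨y, hy⟩ := exists_between hu.2
  have hyI : y ∈ Set.Ioo s t := ⟨hu.1.trans hy.1, hy.2⟩
  exact (h.strictMonoOn hu hyI hy.1).trans_le (le_csSup h2 ⟨y, hyI, rfl⟩)

theorem image_eq_Ioi (h1 : BddBelow (ψ '' Set.Ioo s t)) (h2 : ¬ BddAbove (ψ '' Set.Ioo s t)) :
    ψ '' Set.Ioo s t = Set.Ioi (sInf (ψ '' Set.Ioo s t)) := by
  refine (Set.Subset.antisymm ?_ (h.isPreconnected_image.Ioi_csInf_subset h1 h2))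
  rintro _ ⟨u, hu, rfl⟩
  obtain ⟨x, hx⟩ := exists_between hu.1
  have hxI : x ∈ Set.Ioo s t := ⟨hx.1, hx.2.trans hu.2⟩
  exact (csInf_le h1 ⟨x, hxI, rfl⟩).trans_lt (h.strictMonoOn hxI hu hx.2)

theorem hasLimitFromBelow (h2 : BddAbove (ψ '' Set.Ioo s t)) :
    HasLimitFromBelow B t (Complex.exp ((sSup (ψ '' Set.Ioo s t) : ℝ) * Complex.I)) := by
  have h1 := h.strictMonoOn.monotoneOn.tendsto_nhdsWithin_Ioo_left (Set.nonempty_Ioo.2 h.lt) h2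
  have hc : Continuous fun u : ℝ => Complex.exp (u * Complex.I) := by fun_prop
  refine ((hc.tendsto _).comp h1).congr' ?_
  filter_upwards [Ioo_mem_nhdsLT h.lt] with u hu
  exact (h.boundaryValue_eq u hu).symm

theorem hasLimitFromAbove (h2 : BddBelow (ψ '' Set.Ioo s t)) :
    HasLimitFromAbove B s (Complex.exp ((sInf (ψ '' Set.Ioo s t) : ℝ) * Complex.I)) := by
  have h1 := h.strictMonoOn.monotoneOn.tendsto_nhdsWithin_Ioo_right (Set.nonempty_Ioo.2 h.lt) h2
  have hc : Continuous fun u : ℝ => Complex.exp (u * Complex.I) := by fun_prop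
  refine ((hc.tendsto _).comp h1).congr' ?_
  filter_upwards [Ioo_mem_nhdsGT h.lt] with u hu
  exact (h.boundaryValue_eq u hu).symm

end IsArgumentOn

/-- The second arc ends at $\theta_0+2\pi$, whereas its limit is wanted at $\theta_0$. -/
theorem HasLimitFromBelow.of_add_two_pi {f : ℂ → ℂ} {θ : ℝ} {L : ℂ}
    (h : HasLimitFromBelow f (θ + 2 * Real.pi) L) : HasLimitFromBelow f θ L := by
  unfold HasLimitFromBelow at *
  have h1 : Tendsto (fun α : ℝ => α + 2 * Real.pi) (𝓝[<] θ) (𝓝[<] (θ + 2 * Real.pi)) :=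
    tendsto_nhdsWithin_iff.2 ⟨((continuous_add_const _).tendsto θ).mono_left nhdsWithin_le_nhds,
      eventually_nhdsWithin_of_forall fun α hα => by simpa using hα⟩
  simpa [Function.comp_def] using h.comp h1

/-! ### Self-maps of a circle cut into two arcs -/

/-- The map is $\chi^{-1}(\psi+C)$, continued by the constants $c$ and $d$. Being monotone and onto
$[c,d]$, it is continuous, with no continuity of $\psi$ or $\chi$ needed. -/
theorem StrictMonoOn.exists_conjugating_map {a b c d C : ℝ} {ψ χ : ℝ → ℝ} (hab : a < b)
    (hcd : c < d) (hψ : StrictMonoOn ψ (Set.Ioo a b)) (hχ : StrictMonoOn χ (Set.Ioo c d))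
    (himg : χ '' Set.Ioo c d = (· + C) '' (ψ '' Set.Ioo a b)) :
    ∃ e : ℝ → ℝ, Continuous e ∧ e a = c ∧ e b = d ∧
      ∀ u ∈ Set.Ioo a b, e u ∈ Set.Ioo c d ∧ χ (e u) = ψ u + C := by
  have h0 : ∀ u ∈ Set.Ioo a b, ∃ v, v ∈ Set.Ioo c d ∧ χ v = ψ u + C := by
    intro u hu
    have : ψ u + C ∈ χ '' Set.Ioo c d := himg ▸ ⟨_, ⟨u, hu, rfl⟩, rfl⟩
    exact this
  choose! e₀ he₀ he₀' using h0
  set e : ℝ → ℝ := fun u => if u ≤ a then c else if b ≤ u then d else e₀ u with he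
  have hea : ∀ u ≤ a, e u = c := fun u hu => if_pos hu
  have heb : ∀ u, b ≤ u → e u = d := fun u hu => by
    simp only [he]
    rw [if_neg (hab.trans_le hu).not_ge, if_pos hu]
  have hei : ∀ u ∈ Set.Ioo a b, e u = e₀ u := fun u hu => by
    simp only [he]
    rw [if_neg hu.1.not_ge, if_neg hu.2.not_ge]
  have hIcc : ∀ u, e u ∈ Set.Icc c d := by
    intro u
    rcases le_or_gt u a with h1 | h1
    · rw [hea u h1]; exact Set.left_mem_Icc.2 hcd.le
    rcases le_or_gt b u with h2 | h2
    · rw [heb u h2]; exact Set.right_mem_Icc.2 hcd.le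
    · rw [hei u ⟨h1, h2⟩]; exact Set.Ioo_subset_Icc_self (he₀ u ⟨h1, h2⟩)
  have hmono : Monotone e := by
    intro u v huv
    rcases le_or_gt u a with h1 | h1
    · rw [hea u h1]; exact (hIcc v).1
    rcases le_or_gt b v with h2 | h2
    · rw [heb v h2]; exact (hIcc u).2
    have hu : u ∈ Set.Ioo a b := ⟨h1, huv.trans_lt h2⟩
    have hv : v ∈ Set.Ioo a b := ⟨h1.trans_le huv, h2⟩
    rw [hei u hu, hei v hv, ← hχ.le_iff_le (he₀ u hu) (he₀ v hv), he₀' u hu, he₀' v hv]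
    linarith [hψ.monotoneOn hu hv huv]
  have hsurj : Function.Surjective fun u => (⟨e u, hIcc u⟩ : Set.Icc c d) := by
    rintro ⟨v, hv⟩
    rcases hv.1.eq_or_lt with rfl | h1
    · exact ⟨a, Subtype.ext (hea a le_rfl)⟩
    rcases hv.2.eq_or_lt with rfl | h2
    · exact ⟨b, Subtype.ext (heb b le_rfl)⟩
    have h3 : χ v ∈ (· + C) '' (ψ '' Set.Ioo a b) := himg ▸ ⟨v, ⟨h1, h2⟩, rfl⟩
    obtain ⟨_, ⟨u, hu, rfl⟩, huv⟩ := h3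
    refine ⟨u, Subtype.ext ((hei u hu).trans ?_)⟩
    exact hχ.injOn (he₀ u hu) ⟨h1, h2⟩ ((he₀' u hu).trans huv)
  have hmono' : Monotone fun u => (⟨e u, hIcc u⟩ : Set.Icc c d) := fun u v huv => hmono huv
  refine ⟨e, continuous_subtype_val.comp (hmono'.continuous_of_surjective hsurj),
    hea a le_rfl, heb b le_rfl, fun u hu => ?_⟩
  rw [hei u hu]
  exact ⟨he₀ u hu, he₀' u hu⟩

/-- The circle is cut by the two singular points `e ^ (i s k)` of `B` into the open arcs from
`e ^ (i s k)` to `e ^ (i t k)`, on which `ψ k` is an argument of `B`. -/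
structure IsTwoArcArgument (B : ℂ → ℂ) (s t : ZMod 2 → ℝ) (ψ : ZMod 2 → ℝ → ℝ) : Prop where
  isArgumentOn : ∀ k, IsArgumentOn B (s k) (t k) (ψ k)
  exp_right : ∀ k, Circle.exp (t k) = Circle.exp (s (k + 1))
  exists_exp_eq : ∀ ζ, ∃ k, ∃ u ∈ Set.Ico (s k) (t k), Circle.exp u = ζ
  eq_of_exp_eq : ∀ k l, ∀ u ∈ Set.Ico (s k) (t k), ∀ v ∈ Set.Ico (s l) (t l),
    Circle.exp u = Circle.exp v → k = l ∧ u = v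
  mem_boundarySpectrum_iff : ∀ ζ, ζ ∈ boundarySpectrum B ↔ ∃ k, ζ = Circle.exp (s k)

/-- `x` maps the `k`-th arc onto the arc with index `k + g`, and adds `2 π m (k + g)` to the
argument. -/
def ShiftsArgument (s t : ZMod 2 → ℝ) (ψ : ZMod 2 → ℝ → ℝ) (x : Circle → Circle)
    (g : ZMod 2) (m : ZMod 2 → ℤ) : Prop :=
  (∀ k, x (Circle.exp (s k)) = Circle.exp (s (k + g))) ∧
  ∀ k, ∀ u ∈ Set.Ioo (s k) (t k), ∃ v ∈ Set.Ioo (s (k + g)) (t (k + g)),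
    x (Circle.exp u) = Circle.exp v ∧ ψ (k + g) v = ψ k u + m (k + g) * (2 * Real.pi)

/-- The shift of arguments described by `g` and `m` respects the ranges of the arguments. -/
def IsAdmissibleShift (s t : ZMod 2 → ℝ) (ψ : ZMod 2 → ℝ → ℝ) (g : ZMod 2) (m : ZMod 2 → ℤ) :
    Prop :=
  ∀ k, ψ (k + g) '' Set.Ioo (s (k + g)) (t (k + g)) =
    (· + (m (k + g) : ℝ) * (2 * Real.pi)) '' (ψ k '' Set.Ioo (s k) (t k))

namespace IsTwoArcArgument

variable {B : ℂ → ℂ} {s t : ZMod 2 → ℝ} {ψ : ZMod 2 → ℝ → ℝ} (h : IsTwoArcArgument B s t ψ)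
include h

theorem exp_notMem {k : ZMod 2} {u : ℝ} (hu : u ∈ Set.Ioo (s k) (t k)) :
    Circle.exp u ∉ boundarySpectrum B := by
  rw [h.mem_boundarySpectrum_iff]
  rintro ⟨l, hl⟩
  obtain ⟨rfl, rfl⟩ := h.eq_of_exp_eq k l u (Set.Ioo_subset_Ico_self hu) (s l)
    (Set.left_mem_Ico.2 (h.isArgumentOn l).lt) hl
  exact lt_irrefl _ hu.1

theorem exists_of_notMem {ζ : Circle} (hζ : ζ ∉ boundarySpectrum B) :
    ∃ k, ∃ u ∈ Set.Ioo (s k) (t k), Circle.exp u = ζ := by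
  obtain ⟨k, u, hu, rfl⟩ := h.exists_exp_eq ζ
  refine ⟨k, u, ⟨hu.1.lt_of_ne ?_, hu.2⟩, rfl⟩
  rintro rfl
  exact hζ ((h.mem_boundarySpectrum_iff _).2 ⟨k, rfl⟩)

theorem exists_coordinates : ∃ (κ : Circle → ZMod 2) (τ : Circle → ℝ),
    (∀ ζ, τ ζ ∈ Set.Ico (s (κ ζ)) (t (κ ζ)) ∧ Circle.exp (τ ζ) = ζ) ∧
    ∀ k, ∀ u ∈ Set.Ico (s k) (t k), κ (Circle.exp u) = k ∧ τ (Circle.exp u) = u := by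
  choose κ τ hτ hexp using h.exists_exp_eq
  exact ⟨κ, τ, fun ζ => ⟨hτ ζ, hexp ζ⟩, fun k u hu => h.eq_of_exp_eq _ _ _ (hτ _) _ hu (hexp _)⟩

/-- A single function on the circle allows composition with $x$. Continuity descends because
`Circle.exp` is open; the values at the singular points are irrelevant. -/
theorem exists_circle_argument : ∃ Λ : Circle → ℝ, ∀ k, ∀ u ∈ Set.Ioo (s k) (t k),
    Λ (Circle.exp u) = ψ k u ∧ ContinuousAt Λ (Circle.exp u) := by
  obtain ⟨κ, τ, -, hκ⟩ := h.exists_coordinates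
  have hΛ : ∀ k, ∀ u ∈ Set.Ioo (s k) (t k),
      ψ (κ (Circle.exp u)) (τ (Circle.exp u)) = ψ k u := fun k u hu => by
    obtain ⟨h1, h2⟩ := hκ k u (Set.Ioo_subset_Ico_self hu)
    rw [h1, h2]
  refine ⟨fun ζ => ψ (κ ζ) (τ ζ), fun k u hu => ⟨hΛ k u hu, ?_⟩⟩
  intro V hV
  simp only [hΛ k u hu] at hV
  have hc := ((h.isArgumentOn k).continuousOn.continuousAt (isOpen_Ioo.mem_nhds hu)) hV
  refine mem_map.2 (mem_of_superset (isLocalHomeomorph_circleExp.isOpenMap.image_mem_nhds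
    (inter_mem (isOpen_Ioo.mem_nhds hu) hc)) ?_)
  rintro _ ⟨v, ⟨hv, hvV⟩, rfl⟩
  simpa only [Set.mem_preimage, hΛ k v hv] using hvV

omit h in
theorem isOpen_openArc (a b : ℝ) : IsOpen (openArc a b) :=
  isLocalHomeomorph_circleExp.isOpenMap _ isOpen_Ioo

omit h in
theorem isPreconnected_openArc (a b : ℝ) : IsPreconnected (openArc a b) :=
  isPreconnected_Ioo.image _ Circle.exp.continuous.continuousOn

theorem index_eq_of_mem_openArc {k l : ZMod 2} {ζ : Circle} (hk : ζ ∈ openArc (s k) (t k))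
    (hl : ζ ∈ openArc (s l) (t l)) : k = l := by
  obtain ⟨u, hu, rfl⟩ := hk
  obtain ⟨v, hv, he⟩ := hl
  exact (h.eq_of_exp_eq k l u (Set.Ioo_subset_Ico_self hu) v (Set.Ioo_subset_Ico_self hv) he.symm).1

theorem exists_image_subset {x : Circle → Circle} (hx : Continuous x)
    (hreg : ∀ ζ, ζ ∉ boundarySpectrum B → x ζ ∉ boundarySpectrum B) (k : ZMod 2) :
    ∃ l, x '' openArc (s k) (t k) ⊆ openArc (s l) (t l) := by
  obtain ⟨m, hm⟩ := Set.nonempty_Ioo.2 (h.isArgumentOn k).lt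
  obtain ⟨l, v, hv, hvm⟩ := h.exists_of_notMem (hreg _ (h.exp_notMem hm))
  have hpre : IsPreconnected (x '' openArc (s k) (t k)) :=
    (isPreconnected_openArc _ _).image _ hx.continuousOn
  refine ⟨l, hpre.subset_left_of_subset_union (isOpen_openArc _ _)
    (isOpen_iUnion fun j => isOpen_iUnion fun _ : j ≠ l => isOpen_openArc (s j) (t j)) ?_ ?_ ?_⟩
  · rw [Set.disjoint_left]
    intro ζ h1 h2
    simp only [Set.mem_iUnion] at h2
    obtain ⟨j, hj, h2⟩ := h2
    exact hj (h.index_eq_of_mem_openArc h2 h1)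
  · rintro _ ⟨_, ⟨u, hu, rfl⟩, rfl⟩
    obtain ⟨j, w, hw, hwu⟩ := h.exists_of_notMem (hreg _ (h.exp_notMem hu))
    by_cases hj : j = l
    · exact Or.inl (hj ▸ ⟨w, hw, hwu⟩)
    · exact Or.inr (Set.mem_iUnion₂.2 ⟨j, hj, w, hw, hwu⟩)
  · exact ⟨_, ⟨_, ⟨m, hm, rfl⟩, rfl⟩, v, hv, hvm⟩

/-- In the coordinates $\psi$ the map $x$ is a translation by a constant of $2\pi\mathbb Z$. Its
image is open and relatively closed in the target arc, so it fills the arc; the increasing extension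
to the closed arc then settles the end points. -/
theorem exists_shift {x : Function.End Circle} (hx : x ∈ continuousInvariants B) (k : ZMod 2) :
    ∃ (l : ZMod 2) (n : ℤ), x (Circle.exp (s k)) = Circle.exp (s l) ∧
      x (Circle.exp (t k)) = Circle.exp (t l) ∧
      (∀ u ∈ Set.Ioo (s k) (t k), ∃ v ∈ Set.Ioo (s l) (t l),
        x (Circle.exp u) = Circle.exp v ∧ ψ l v = ψ k u + n * (2 * Real.pi)) ∧
      ψ l '' Set.Ioo (s l) (t l) =
        (· + (n : ℝ) * (2 * Real.pi)) '' (ψ k '' Set.Ioo (s k) (t k)) := by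
  obtain ⟨hcont, hsing, hreg, hval⟩ := hx
  obtain ⟨l, hl⟩ := h.exists_image_subset hcont hreg k
  obtain ⟨Λ, hΛ⟩ := h.exists_circle_argument
  have hxv : ∀ u ∈ Set.Ioo (s k) (t k), ∃ v ∈ Set.Ioo (s l) (t l), Circle.exp v = x (Circle.exp u) :=
    fun u hu => hl ⟨_, ⟨u, hu, rfl⟩, rfl⟩
  have hcq : ContinuousOn (fun u => (Λ (x (Circle.exp u)) - ψ k u) / (2 * Real.pi))
      (Set.Ioo (s k) (t k)) := by
    refine ContinuousOn.div_const (ContinuousOn.sub (fun u hu => ?_)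
      (h.isArgumentOn k).continuousOn) _
    obtain ⟨v, hv, hvu⟩ := hxv u hu
    have h1 : ContinuousAt Λ (x (Circle.exp u)) := hvu ▸ (hΛ l v hv).2
    exact (ContinuousAt.comp (f := fun u => x (Circle.exp u)) h1
      (hcont.comp Circle.exp.continuous).continuousAt).continuousWithinAt
  have hmaps : Set.MapsTo (fun u => (Λ (x (Circle.exp u)) - ψ k u) / (2 * Real.pi))
      (Set.Ioo (s k) (t k)) (Set.range ((↑) : ℤ → ℝ)) := by
    intro u hu
    obtain ⟨v, hv, hvu⟩ := hxv u hu
    have h1 := hval _ (h.exp_notMem hu)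
    rw [← hvu, (h.isArgumentOn l).boundaryValue_eq v hv, (h.isArgumentOn k).boundaryValue_eq u hu,
      Complex.exp_eq_exp_iff_exists_int] at h1
    obtain ⟨n, hn⟩ := h1
    refine ⟨n, ?_⟩
    rw [← mul_assoc, ← add_mul, mul_left_inj' Complex.I_ne_zero] at hn
    have hn' : ψ l v = ψ k u + n * (2 * Real.pi) := by exact_mod_cast hn
    simp only [← hvu, (hΛ l v hv).1, hn']
    field_simp
    ring
  obtain ⟨m, hm⟩ := Set.nonempty_Ioo.2 (h.isArgumentOn k).lt
  obtain ⟨n, hn⟩ := hmaps hm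
  have hshift : ∀ u ∈ Set.Ioo (s k) (t k), Λ (x (Circle.exp u)) = ψ k u + n * (2 * Real.pi) := by
    intro u hu
    -- A continuous function on an interval with values in the discrete set $\mathbb Z$ is constant.
    have h1 := isPreconnected_Ioo.constant_of_mapsTo
      Int.isClosedEmbedding_coe_real.isDiscrete_range hcq hmaps hu hm
    simp only at h1 hn
    rw [← hn, div_eq_iff Real.two_pi_pos.ne'] at h1
    linarith
  have hpt : ∀ u ∈ Set.Ioo (s k) (t k), ∃ v ∈ Set.Ioo (s l) (t l),
      x (Circle.exp u) = Circle.exp v ∧ ψ l v = ψ k u + n * (2 * Real.pi) := by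
    intro u hu
    obtain ⟨v, hv, hvu⟩ := hxv u hu
    refine ⟨v, hv, hvu.symm, ?_⟩
    rw [← (hΛ l v hv).1, hvu, hshift u hu]
  have hsub : (· + (n : ℝ) * (2 * Real.pi)) '' (ψ k '' Set.Ioo (s k) (t k)) ⊆
      ψ l '' Set.Ioo (s l) (t l) := by
    rintro _ ⟨_, ⟨u, hu, rfl⟩, rfl⟩
    obtain ⟨v, hv, -, hv'⟩ := hpt u hu
    exact ⟨v, hv, hv'⟩
  have himg : x '' openArc (s k) (t k) = {ζ ∈ openArc (s l) (t l) |
      Λ ζ ∈ (· + (n : ℝ) * (2 * Real.pi)) '' (ψ k '' Set.Ioo (s k) (t k))} := by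
    ext ζ
    constructor
    · rintro ⟨_, ⟨u, hu, rfl⟩, rfl⟩
      exact ⟨hl ⟨_, ⟨u, hu, rfl⟩, rfl⟩, _, ⟨u, hu, rfl⟩, (hshift u hu).symm⟩
    · rintro ⟨⟨w, hw, rfl⟩, _, ⟨u, hu, rfl⟩, hwu⟩
      obtain ⟨v, hv, hxu, hv'⟩ := hpt u hu
      refine ⟨_, ⟨u, hu, rfl⟩, hxu.trans ?_⟩
      rw [(h.isArgumentOn l).strictMonoOn.injOn hv hw]
      rw [hv', ← (hΛ l w hw).1, ← hwu]
  have hopen : IsOpen (x '' openArc (s k) (t k)) := by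
    rw [himg, isOpen_iff_mem_nhds]
    rintro _ ⟨⟨w, hw, rfl⟩, hwΛ⟩
    exact inter_mem ((isOpen_openArc _ _).mem_nhds ⟨w, hw, rfl⟩)
      ((hΛ l w hw).2.preimage_mem_nhds
        (((Homeomorph.addRight ((n : ℝ) * (2 * Real.pi))).isOpenMap _
          (h.isArgumentOn k).isOpen_image).mem_nhds hwΛ))
  -- By compactness a limit point of the image is the image of a point of the closed arc. If it is
  -- regular, that point is not an end, because ends go to singular points.
  have hcl : closure (x '' openArc (s k) (t k)) ∩ openArc (s l) (t l) ⊆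
      x '' openArc (s k) (t k) := by
    have h1 : closure (x '' openArc (s k) (t k)) ⊆
        (fun u => x (Circle.exp u)) '' Set.Icc (s k) (t k) := by
      refine closure_minimal ?_ (isCompact_Icc.image
        (hcont.comp Circle.exp.continuous)).isClosed
      rintro _ ⟨_, ⟨u, hu, rfl⟩, rfl⟩
      exact ⟨u, Set.Ioo_subset_Icc_self hu, rfl⟩
    rintro ζ ⟨hζ, w, hw, rfl⟩
    obtain ⟨u, hu, huw⟩ := h1 hζ
    have hns : x (Circle.exp u) ∉ boundarySpectrum B := by
      simp only at huw
      rw [huw]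
      exact h.exp_notMem hw
    refine ⟨_, ⟨u, ⟨hu.1.lt_of_ne ?_, hu.2.lt_of_ne ?_⟩, rfl⟩, huw⟩
    · rintro rfl
      exact hns (hsing _ ((h.mem_boundarySpectrum_iff _).2 ⟨k, rfl⟩))
    · rintro rfl
      exact hns (hsing _ ((h.mem_boundarySpectrum_iff _).2 ⟨k + 1, h.exp_right k⟩))
  have hfull : openArc (s l) (t l) ⊆ x '' openArc (s k) (t k) := by
    refine (isPreconnected_openArc _ _).subset_of_closure_inter_subset hopen ?_ hcl
    exact ⟨_, hl ⟨_, ⟨m, hm, rfl⟩, rfl⟩, ⟨_, ⟨m, hm, rfl⟩, rfl⟩⟩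
  have himage : ψ l '' Set.Ioo (s l) (t l) =
      (· + (n : ℝ) * (2 * Real.pi)) '' (ψ k '' Set.Ioo (s k) (t k)) := by
    refine Set.Subset.antisymm ?_ hsub
    rintro _ ⟨w, hw, rfl⟩
    have h1 := hfull ⟨w, hw, rfl⟩
    rw [himg] at h1
    rw [← (hΛ l w hw).1]
    exact h1.2
  obtain ⟨e, hec, hes, het, hei⟩ := StrictMonoOn.exists_conjugating_map (h.isArgumentOn k).lt
    (h.isArgumentOn l).lt (h.isArgumentOn k).strictMonoOn (h.isArgumentOn l).strictMonoOn himage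
  -- Both sides are continuous and agree on the open arc, hence also at its ends.
  have heq : Set.EqOn (fun u => x (Circle.exp u)) (fun u => Circle.exp (e u))
      (Set.Icc (s k) (t k)) := by
    rw [← closure_Ioo (h.isArgumentOn k).lt.ne]
    refine Set.EqOn.closure (fun u hu => ?_) (hcont.comp Circle.exp.continuous)
      (Circle.exp.continuous.comp hec)
    obtain ⟨v, hv, hxu, hv'⟩ := hpt u hu
    rw [hxu, (h.isArgumentOn l).strictMonoOn.injOn hv (hei u hu).1 (hv'.trans (hei u hu).2.symm)]
  refine ⟨l, n, ?_, ?_, hpt, himage⟩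
  · rw [← hes]; exact heq (Set.left_mem_Icc.2 (h.isArgumentOn k).lt.le)
  · rw [← het]; exact heq (Set.right_mem_Icc.2 (h.isArgumentOn k).lt.le)

theorem eq_of_exp_left_eq {k l : ZMod 2} (he : Circle.exp (s k) = Circle.exp (s l)) : k = l :=
  (h.eq_of_exp_eq k l _ (Set.left_mem_Ico.2 (h.isArgumentOn k).lt) _
    (Set.left_mem_Ico.2 (h.isArgumentOn l).lt) he).1

/-- The end of arc $k$ is the start of arc $k+1$, and $x$ sends initial points to initial points and
final points to final points. So the map of indices commutes with $k\mapsto k+1$, that is, it adds a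
constant $g$. -/
theorem exists_shiftsArgument {x : Function.End Circle} (hx : x ∈ continuousInvariants B) :
    ∃ g m, ShiftsArgument s t ψ x g m ∧ IsAdmissibleShift s t ψ g m := by
  choose l n hs ht hpt himg using h.exists_shift hx
  have hl : ∀ k, l (k + 1) = l k + 1 := fun k => h.eq_of_exp_left_eq (by
    rw [← hs, ← h.exp_right, ht, h.exp_right])
  have hl' : ∀ k, l k = k + l 0 := by
    intro k
    rcases (by decide : ∀ k : ZMod 2, k = 0 ∨ k = 1) k with rfl | rfl
    · rw [zero_add]
    · have := hl 0
      rwa [zero_add, add_comm] at this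
  refine ⟨l 0, fun j => n (j - l 0), ⟨fun k => ?_, fun k u hu => ?_⟩, fun k => ?_⟩
  · rw [hs, hl']
  · have := hpt k u hu
    rw [hl'] at this
    simpa using this
  · have := himg k
    rw [hl'] at this
    simpa using this

theorem shiftsArgument_unique {x : Circle → Circle} {g g' : ZMod 2} {m m' : ZMod 2 → ℤ}
    (h1 : ShiftsArgument s t ψ x g m) (h2 : ShiftsArgument s t ψ x g' m') : g = g' ∧ m = m' := by
  have hg : g = g' := by
    have := h.eq_of_exp_left_eq ((h1.1 0).symm.trans (h2.1 0))
    simpa using this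
  subst hg
  refine ⟨rfl, funext fun l => ?_⟩
  obtain ⟨k, rfl⟩ : ∃ k, l = k + g := ⟨l - g, by ring⟩
  obtain ⟨u, hu⟩ := Set.nonempty_Ioo.2 (h.isArgumentOn k).lt
  obtain ⟨v, hv, hxv, hv'⟩ := h1.2 k u hu
  obtain ⟨w, hw, hxw, hw'⟩ := h2.2 k u hu
  have hvw := (h.eq_of_exp_eq _ _ v (Set.Ioo_subset_Ico_self hv) w (Set.Ioo_subset_Ico_self hw)
    (hxv.symm.trans hxw)).2
  rw [hvw, hw'] at hv'
  have h3 := mul_right_cancel₀ Real.two_pi_pos.ne' (add_left_cancel hv')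
  exact_mod_cast h3.symm

theorem eq_of_shiftsArgument {x y : Circle → Circle} {g : ZMod 2} {m : ZMod 2 → ℤ}
    (h1 : ShiftsArgument s t ψ x g m) (h2 : ShiftsArgument s t ψ y g m) : x = y := by
  funext ζ
  obtain ⟨k, u, hu, rfl⟩ := h.exists_exp_eq ζ
  rcases hu.1.eq_or_lt with rfl | hlt
  · rw [h1.1, h2.1]
  · obtain ⟨v, hv, hxv, hv'⟩ := h1.2 k u ⟨hlt, hu.2⟩
    obtain ⟨w, hw, hxw, hw'⟩ := h2.2 k u ⟨hlt, hu.2⟩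
    rw [hxv, hxw, (h.isArgumentOn _).strictMonoOn.injOn hv hw (hv'.trans hw'.symm)]

omit h in
-- The integers are indexed by the target arc: a point arriving in arc $l$ came through arc $l-g$,
-- where $y$ had added $m'(l-g)$. This is the twisted product of $\mathbb Z^2\rtimes\mathbb Z_2$.
theorem shiftsArgument_comp {x y : Circle → Circle} {g g' : ZMod 2} {m m' : ZMod 2 → ℤ}
    (h1 : ShiftsArgument s t ψ x g m) (h2 : ShiftsArgument s t ψ y g' m') :
    ShiftsArgument s t ψ (x ∘ y) (g + g') (fun l => m l + m' (l - g)) := by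
  have hidx : ∀ k, k + (g + g') = k + g' + g := fun k => by ring
  refine ⟨fun k => ?_, fun k u hu => ?_⟩
  · rw [Function.comp_apply, h2.1, h1.1, hidx]
  · obtain ⟨v, hv, hyv, hv'⟩ := h2.2 k u hu
    obtain ⟨w, hw, hxw, hw'⟩ := h1.2 _ v hv
    rw [hidx]
    refine ⟨w, hw, by rw [Function.comp_apply, hyv, hxw], ?_⟩
    simp only [hw', hv', add_sub_cancel_right]
    push_cast
    ring

/-- The conjugating maps of the two arcs are increasing and match at the singular points, so they
glue. -/
theorem exists_mem_of_isAdmissibleShift {g : ZMod 2} {m : ZMod 2 → ℤ}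
    (hadm : IsAdmissibleShift s t ψ g m) :
    ∃ x ∈ continuousInvariants B, ShiftsArgument s t ψ x g m := by
  have hex := fun k => StrictMonoOn.exists_conjugating_map (h.isArgumentOn k).lt
    (h.isArgumentOn (k + g)).lt (h.isArgumentOn k).strictMonoOn
    (h.isArgumentOn (k + g)).strictMonoOn (hadm k)
  choose e hec hes het hei using hex
  obtain ⟨κ, τ, hτ, hκ⟩ := h.exists_coordinates
  set x : Function.End Circle := fun ζ => Circle.exp (e (κ ζ) (τ ζ)) with hxdef
  have hxe : ∀ k, ∀ u ∈ Set.Ico (s k) (t k), x (Circle.exp u) = Circle.exp (e k u) := by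
    intro k u hu
    simp only [hxdef, (hκ k u hu).1, (hκ k u hu).2]
  have hx_left : ∀ k, x (Circle.exp (s k)) = Circle.exp (s (k + g)) := fun k => by
    rw [hxe k _ (Set.left_mem_Ico.2 (h.isArgumentOn k).lt), hes]
  have hxe' : ∀ k, ∀ u ∈ Set.Icc (s k) (t k), x (Circle.exp u) = Circle.exp (e k u) := by
    intro k u hu
    rcases hu.2.eq_or_lt with rfl | hlt
    · rw [h.exp_right, hx_left, het, h.exp_right]
      congr 2
      ring
    · exact hxe k u ⟨hu.1, hlt⟩
  have hcont : Continuous fun ζ : Circle => x ζ := by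
    -- The circle is a quotient of the disjoint union of the two closed arcs (compact onto
    -- Hausdorff), so continuity may be checked on each closed arc.
    have hq : IsQuotientMap fun q : (k : ZMod 2) × Set.Icc (s k) (t k) =>
        Circle.exp (q.2 : ℝ) := by
      refine IsQuotientMap.of_surjective_continuous (fun ζ => ?_) ?_
      · exact ⟨⟨κ ζ, τ ζ, Set.Ico_subset_Icc_self (hτ ζ).1⟩, (hτ ζ).2⟩
      · exact continuous_sigma fun k => Circle.exp.continuous.comp continuous_subtype_val
    rw [hq.continuous_iff]
    refine continuous_sigma fun k => ?_
    refine Continuous.congr (f := fun q : Set.Icc (s k) (t k) => Circle.exp (e k q))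
      (Circle.exp.continuous.comp ((hec k).comp continuous_subtype_val)) fun q => ?_
    exact (hxe' k q q.2).symm
  have hshift : ShiftsArgument s t ψ x g m :=
    ⟨hx_left, fun k u hu => ⟨e k u, (hei k u hu).1, hxe k u (Set.Ioo_subset_Ico_self hu),
      (hei k u hu).2⟩⟩
  refine ⟨x, ⟨hcont, fun ζ hζ => ?_, fun ζ hζ => ?_, fun ζ hζ => ?_⟩, hshift⟩
  · obtain ⟨k, rfl⟩ := (h.mem_boundarySpectrum_iff _).1 hζ
    exact (h.mem_boundarySpectrum_iff _).2 ⟨_, hx_left k⟩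
  · obtain ⟨k, u, hu, rfl⟩ := h.exists_of_notMem hζ
    obtain ⟨v, hv, hxv, -⟩ := hshift.2 k u hu
    rw [hxv]
    exact h.exp_notMem hv
  · obtain ⟨k, u, hu, rfl⟩ := h.exists_of_notMem hζ
    obtain ⟨v, hv, hxv, hv'⟩ := hshift.2 k u hu
    rw [hxv, (h.isArgumentOn _).boundaryValue_eq v hv, (h.isArgumentOn k).boundaryValue_eq u hu,
      hv', Complex.exp_eq_exp_iff_exists_int]
    refine ⟨m (k + g), ?_⟩
    push_cast
    ring

end IsTwoArcArgument

/-! ### The group `ℤ² ⋊ ℤ/2` -/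

theorem zmod_two_eq_zero_or_one (g : ZMod 2) : g = 0 ∨ g = 1 := by
  revert g
  decide

theorem zmod_two_eq_add_one_of_ne {j k : ZMod 2} : j ≠ k → j = k + 1 := by
  revert j k
  decide

theorem coordinateSwapAction_ofAdd_one (v : Multiplicative ℤ × Multiplicative ℤ) :
    coordinateSwapAction (Multiplicative.ofAdd 1) v = v.swap := by
  have h : Multiplicative.ofAdd (1 : ZMod 2) ≠ 1 := by decide
  simp [coordinateSwapAction, h, Prod.swap]

/-- The element of `ℤ² ⋊ ℤ/2` with components `m 0`, `m 1` and `g`. -/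
def shiftElement (g : ZMod 2) (m : ZMod 2 → ℤ) : ZSqSemidirectZTwo :=
  ⟨(Multiplicative.ofAdd (m 0), Multiplicative.ofAdd (m 1)), Multiplicative.ofAdd g⟩

theorem shiftElement_mul (g g' : ZMod 2) (m m' : ZMod 2 → ℤ) :
    shiftElement g m * shiftElement g' m' =
      shiftElement (g + g') (fun l => m l + m' (l - g)) := by
  refine SemidirectProduct.ext ?_ rfl
  rcases zmod_two_eq_zero_or_one g with rfl | rfl
  · simp [shiftElement]
  · have h1 : (0 : ZMod 2) - 1 = 1 := by decide
    simp [shiftElement, coordinateSwapAction_ofAdd_one, h1]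

theorem shiftElement_injective {g g' : ZMod 2} {m m' : ZMod 2 → ℤ}
    (h : shiftElement g m = shiftElement g' m') : g = g' ∧ m = m' := by
  obtain ⟨h1, h2⟩ := SemidirectProduct.ext_iff.1 h
  have h3 := Prod.ext_iff.1 h1
  refine ⟨Multiplicative.ofAdd.injective h2, funext fun k => ?_⟩
  rcases zmod_two_eq_zero_or_one k with rfl | rfl
  · exact Multiplicative.ofAdd.injective h3.1
  · exact Multiplicative.ofAdd.injective h3.2

theorem exists_eq_shiftElement (v : ZSqSemidirectZTwo) : ∃ g m, v = shiftElement g m := by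
  refine ⟨v.right.toAdd, fun k => if k = 0 then v.left.1.toAdd else v.left.2.toAdd, ?_⟩
  refine SemidirectProduct.ext (Prod.ext ?_ ?_) rfl <;> simp [shiftElement]

/-- The invariants are a priori only a monoid; they are identified with a group through their image
in $\mathbb Z^2\rtimes\mathbb Z_2$. -/
theorem nonempty_mulEquiv_of_range_eq {G A M : Type*} [Monoid G] [Monoid A] [Monoid M]
    (f : G →* M) (i : A →* M) (hf : Function.Injective f) (hi : Function.Injective i)
    (h : Set.range f = Set.range i) : Nonempty (G ≃* A) := by
  have h1 : ∀ x, ∃ a, i a = f x := fun x => by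
    have : f x ∈ Set.range i := h ▸ ⟨x, rfl⟩
    exact this
  choose φ hφ using h1
  refine ⟨MulEquiv.ofBijective (⟨φ, fun x y => hi ?_⟩ : G →ₙ* A) ⟨fun x y hxy => hf ?_, fun a => ?_⟩⟩
  · rw [map_mul, hφ, hφ, hφ, map_mul]
  · rw [← hφ, ← hφ]
    exact congrArg i hxy
  · have : i a ∈ Set.range f := h ▸ ⟨a, rfl⟩
    obtain ⟨x, hx⟩ := this
    exact ⟨x, hi ((hφ x).trans hx)⟩

/-- The homomorphism from a group of order two given by an involution. -/
def homOfSqEqOne {P : Type*} [Group P] (y : P) (hy : y ^ 2 = 1) : Multiplicative (ZMod 2) →* P where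
  toFun g := if g = 1 then 1 else y
  map_one' := if_pos rfl
  map_mul' := by
    have h : ∀ g : Multiplicative (ZMod 2), g = 1 ∨ g = Multiplicative.ofAdd 1 := by decide
    have h1 : Multiplicative.ofAdd (1 : ZMod 2) ≠ 1 := by decide
    have h2 : Multiplicative.ofAdd (1 : ZMod 2) * Multiplicative.ofAdd 1 = 1 := by decide
    intro g k
    rcases h g with rfl | rfl <;> rcases h k with rfl | rfl <;> simp [h1, h2, ← sq, hy]

theorem homOfSqEqOne_ofAdd_one {P : Type*} [Group P] (y : P) (hy : y ^ 2 = 1) :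
    homOfSqEqOne y hy (Multiplicative.ofAdd 1) = y := by
  have h : Multiplicative.ofAdd (1 : ZMod 2) ≠ 1 := by decide
  simp [homOfSqEqOne, h]

/-- The universal properties of both sides give homomorphisms that are inverse to each other on
generators. The relations say that $x_1,x_2$ commute and that conjugation by the involution $y$
interchanges them. -/
theorem nonempty_mulEquiv_presentedGroup :
    Nonempty (ZSqSemidirectZTwo ≃* PresentedGroup presentationRelators) := by
  set x₁ : PresentedGroup presentationRelators := PresentedGroup.of PresentationGenerator.x₁
    with hx₁
  set x₂ : PresentedGroup presentationRelators := PresentedGroup.of PresentationGenerator.x₂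
    with hx₂
  set y : PresentedGroup presentationRelators := PresentedGroup.of PresentationGenerator.y with hy
  have hyy : y ^ 2 = 1 := PresentedGroup.one_of_mem (rels := presentationRelators)
    (x := FreeGroup.of PresentationGenerator.y ^ 2) (Or.inl rfl)
  have hxx : x₁ * x₂ = x₂ * x₁ := mul_inv_eq_one.1 (PresentedGroup.one_of_mem
    (rels := presentationRelators) (Or.inr (Or.inl rfl)))
  have hcomm : Commute x₁ x₂ := hxx
  have hxy : x₂ * y = y * x₁ := mul_inv_eq_one.1 (PresentedGroup.one_of_mem
    (rels := presentationRelators) (Or.inr (Or.inr rfl)))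
  have hy1 : y * y = 1 := by rw [← sq, hyy]
  have hconj₁ : y * x₁ * y⁻¹ = x₂ := by rw [← hxy, mul_inv_cancel_right]
  have hconj₂ : y * x₂ * y⁻¹ = x₁ := by
    have hyi : y⁻¹ = y := inv_eq_of_mul_eq_one_right hy1
    rw [hyi, mul_assoc, hxy, ← mul_assoc, hy1, one_mul]
  set N : Multiplicative ℤ × Multiplicative ℤ →* PresentedGroup presentationRelators :=
    (zpowersHom _ x₁).noncommCoprod (zpowersHom _ x₂)
      (fun m n => hcomm.zpow_zpow _ _) with hN
  set a₁ : Multiplicative ℤ × Multiplicative ℤ := (Multiplicative.ofAdd 1, 1) with ha₁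
  set a₂ : Multiplicative ℤ × Multiplicative ℤ := (1, Multiplicative.ofAdd 1) with ha₂
  have hgen : ∀ v : Multiplicative ℤ × Multiplicative ℤ, v = a₁ ^ v.1.toAdd * a₂ ^ v.2.toAdd := by
    intro v
    ext <;> simp [ha₁, ha₂, ← ofAdd_zsmul]
  have hNv : ∀ v : Multiplicative ℤ × Multiplicative ℤ, N v = x₁ ^ v.1.toAdd * x₂ ^ v.2.toAdd :=
    fun _ => rfl
  have hcompat : ∀ g : Multiplicative (ZMod 2),
      N.comp (MulEquiv.toMonoidHom (coordinateSwapAction g)) =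
        (MulEquiv.toMonoidHom (MulAut.conj (homOfSqEqOne y hyy g))).comp N := by
    intro g
    rcases (by decide : ∀ g : Multiplicative (ZMod 2), g = 1 ∨ g = Multiplicative.ofAdd 1) g
      with rfl | rfl
    · ext v; simp
    · refine MonoidHom.ext fun v => ?_
      simp only [MonoidHom.comp_apply, MulEquiv.coe_toMonoidHom, coordinateSwapAction_ofAdd_one,
        homOfSqEqOne_ofAdd_one, hNv, Prod.fst_swap, Prod.snd_swap, map_mul, map_zpow, MulAut.conj_apply, hconj₁, hconj₂]
      exact hcomm.zpow_zpow _ _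
  set F : ZSqSemidirectZTwo →* PresentedGroup presentationRelators :=
    SemidirectProduct.lift N (homOfSqEqOne y hyy) hcompat with hF
  set i : PresentationGenerator → ZSqSemidirectZTwo := fun
    | .x₁ => SemidirectProduct.inl a₁
    | .x₂ => SemidirectProduct.inl a₂
    | .y => SemidirectProduct.inr (Multiplicative.ofAdd 1) with hi
  have hrel : ∀ r ∈ presentationRelators, FreeGroup.lift i r = 1 := by
    rintro r (rfl | rfl | rfl)
    · rw [map_pow, FreeGroup.lift_apply_of, ← map_pow]
      have : Multiplicative.ofAdd (1 : ZMod 2) ^ 2 = 1 := by decide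
      rw [this, map_one]
    · simp only [map_mul, map_inv, FreeGroup.lift_apply_of, mul_inv_eq_one, hi]
      rw [← map_mul, ← map_mul, mul_comm]
    · simp only [map_mul, map_inv, FreeGroup.lift_apply_of, mul_inv_eq_one, hi]
      refine SemidirectProduct.ext ?_ ?_
      · simp [coordinateSwapAction_ofAdd_one, ha₁, ha₂]
      · simp
  refine ⟨MonoidHom.toMulEquiv F (PresentedGroup.toGroup hrel) ?_ ?_⟩
  · refine SemidirectProduct.hom_ext (MonoidHom.ext fun v => ?_) (MonoidHom.ext fun g => ?_)
    · have h1 : F (SemidirectProduct.inl v) = x₁ ^ v.1.toAdd * x₂ ^ v.2.toAdd := by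
        rw [hF, SemidirectProduct.lift_inl, hNv]
      simp only [MonoidHom.comp_apply, h1, map_mul, map_zpow, hx₁, hx₂, PresentedGroup.toGroup.of,
        MonoidHom.id_apply, hi]
      rw [← map_zpow, ← map_zpow, ← map_mul, ← hgen]
    · rcases (by decide : ∀ g : Multiplicative (ZMod 2), g = 1 ∨ g = Multiplicative.ofAdd 1) g
        with rfl | rfl
      · simp
      · simp only [MonoidHom.comp_apply, hF, SemidirectProduct.lift_inr, homOfSqEqOne_ofAdd_one, hy,
          PresentedGroup.toGroup.of, MonoidHom.id_apply, hi]
  · refine PresentedGroup.ext fun g => ?_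
    rw [MonoidHom.comp_apply, PresentedGroup.toGroup.of, MonoidHom.id_apply]
    cases g
    · simp only [hi, hF, SemidirectProduct.lift_inl, hNv, ha₁]
      simp [hx₁]
    · simp only [hi, hF, SemidirectProduct.lift_inl, hNv, ha₂]
      simp [hx₂]
    · simp only [hi, hF, SemidirectProduct.lift_inr, homOfSqEqOne_ofAdd_one, hy]

/-! ### The group of continuous invariants -/

namespace IsTwoArcArgument

variable {B : ℂ → ℂ} {s t : ZMod 2 → ℝ} {ψ : ZMod 2 → ℝ → ℝ} (h : IsTwoArcArgument B s t ψ)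
include h

/-- The coordinates $(m,g)$ of an invariant are unique, determine it and multiply as in the
semidirect product. From here on only the intervals $\psi_k(s_k,t_k)$ matter. -/
theorem exists_monoidHom : ∃ Φ : continuousInvariants B →* ZSqSemidirectZTwo,
    Function.Injective Φ ∧
      ∀ g m, shiftElement g m ∈ Set.range Φ ↔ IsAdmissibleShift s t ψ g m := by
  choose g m hgm hadm using fun x : continuousInvariants B => h.exists_shiftsArgument x.2
  have hmul : ∀ x y, shiftElement (g (x * y)) (m (x * y)) =
      shiftElement (g x) (m x) * shiftElement (g y) (m y) := by
    intro x y
    have hxy : ShiftsArgument s t ψ (x * y : continuousInvariants B).1 (g x + g y)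
        (fun l => m x l + m y (l - g x)) := 
      shiftsArgument_comp (x := x.1) (y := y.1) (hgm x) (hgm y)
    obtain ⟨h1, h2⟩ := h.shiftsArgument_unique (hgm (x * y)) hxy
    rw [shiftElement_mul, h1, h2]
  refine ⟨MonoidHom.mk' (fun x => shiftElement (g x) (m x)) hmul, fun x y hxy => ?_,
    fun g' m' => ⟨?_, fun ha => ?_⟩⟩
  · obtain ⟨h1, h2⟩ := shiftElement_injective hxy
    have hx := hgm x
    rw [h1, h2] at hx
    exact Subtype.ext (h.eq_of_shiftsArgument hx (hgm y))
  · rintro ⟨x, hx⟩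
    obtain ⟨rfl, rfl⟩ := shiftElement_injective hx
    exact hadm x
  · obtain ⟨x, hx, hxs⟩ := h.exists_mem_of_isAdmissibleShift ha
    refine ⟨⟨x, hx⟩, ?_⟩
    obtain ⟨h1, h2⟩ := h.shiftsArgument_unique (hgm ⟨x, hx⟩) hxs
    simp only [MonoidHom.mk'_apply, h1, h2]

theorem nonempty_mulEquiv_semidirectProduct (hJ : ∀ k, ψ k '' Set.Ioo (s k) (t k) = Set.univ) :
    Nonempty (continuousInvariants B ≃* ZSqSemidirectZTwo) := by
  obtain ⟨Φ, hΦ, hrange⟩ := h.exists_monoidHom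
  refine ⟨MulEquiv.ofBijective Φ ⟨hΦ, fun v => ?_⟩⟩
  obtain ⟨g, m, rfl⟩ := exists_eq_shiftElement v
  refine (hrange g m).2 fun k => ?_
  rw [hJ, hJ, Set.image_univ_of_surjective (add_right_surjective _)]

/-- A proper interval is not a translate of $\mathbb R$, which excludes the interchange, and it has
no translation symmetry but $0$. Only the integer of arc $k$ remains free. -/
theorem nonempty_mulEquiv_int {k : ZMod 2} (h1 : ψ k '' Set.Ioo (s k) (t k) = Set.univ)
    (h2 : BddBelow (ψ (k + 1) '' Set.Ioo (s (k + 1)) (t (k + 1))) ∨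
      BddAbove (ψ (k + 1) '' Set.Ioo (s (k + 1)) (t (k + 1)))) :
    Nonempty (continuousInvariants B ≃* Multiplicative ℤ) := by
  obtain ⟨Φ, hΦ, hrange⟩ := h.exists_monoidHom
  have hne : (ψ (k + 1) '' Set.Ioo (s (k + 1)) (t (k + 1))).Nonempty :=
    (Set.nonempty_Ioo.2 (h.isArgumentOn _).lt).image _
  have hnu : ψ (k + 1) '' Set.Ioo (s (k + 1)) (t (k + 1)) ≠ Set.univ := by
    intro hu
    rw [hu] at h2
    rcases h2 with h2 | h2
    · exact not_bddBelow_univ h2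
    · exact not_bddAbove_univ h2
  -- The finite infimum or supremum of the interval moves by $c$ and must stay.
  have hshift : ∀ c : ℝ, ψ (k + 1) '' Set.Ioo (s (k + 1)) (t (k + 1)) =
      (· + c) '' (ψ (k + 1) '' Set.Ioo (s (k + 1)) (t (k + 1))) → c = 0 := by
    intro c hc
    rcases h2 with h2 | h2
    · have h3 := isGLB_csInf hne h2
      have h4 := (OrderIso.addRight c).isGLB_image'.2 h3
      rw [← show _ = (OrderIso.addRight c) '' _ from hc] at h4
      simpa using h3.unique h4
    · have h3 := isLUB_csSup hne h2
      have h4 := ((OrderIso.addRight c).isLUB_image'.2 h3)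
      rw [← show _ = (OrderIso.addRight c) '' _ from hc] at h4
      simpa using h3.unique h4
  have hadm : ∀ g m, IsAdmissibleShift s t ψ g m ↔ g = 0 ∧ m (k + 1) = 0 := by
    intro g m
    constructor
    · intro ha
      have hg : g = 0 := by
        rcases zmod_two_eq_zero_or_one g with rfl | rfl
        · rfl
        · have := ha k
          rw [h1, Set.image_univ_of_surjective (add_right_surjective _)] at this
          exact absurd this hnu
      subst hg
      refine ⟨rfl, ?_⟩
      have h3 := ha (k + 1)
      rw [add_zero] at h3
      have h4 := hshift _ h3
      simpa [Real.pi_ne_zero] using h4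
    · rintro ⟨rfl, hm⟩ j
      rw [add_zero]
      by_cases hj : j = k
      · subst hj
        rw [h1, Set.image_univ_of_surjective (add_right_surjective _)]
      · have hj' : j = k + 1 := zmod_two_eq_add_one_of_ne hj
        rw [hj', hm]
        simp
  have hi : ∃ i : Multiplicative ℤ →* ZSqSemidirectZTwo, Function.Injective i ∧
      ∀ g m, shiftElement g m ∈ Set.range i ↔ g = 0 ∧ m (k + 1) = 0 := by
    rcases zmod_two_eq_zero_or_one k with rfl | rfl
    · refine ⟨SemidirectProduct.inl.comp (MonoidHom.inl _ _), fun a b hab => ?_, fun g m => ⟨?_, ?_⟩⟩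
      · exact (Prod.ext_iff.1 (SemidirectProduct.inl_injective hab)).1
      · rintro ⟨a, ha⟩
        obtain ⟨ha1, ha2⟩ := SemidirectProduct.ext_iff.1 ha
        exact ⟨(Multiplicative.ofAdd.injective ha2).symm,
          (Multiplicative.ofAdd.injective (Prod.ext_iff.1 ha1).2).symm⟩
      · rintro ⟨rfl, hm⟩
        refine ⟨Multiplicative.ofAdd (m 0), SemidirectProduct.ext (Prod.ext rfl ?_) rfl⟩
        exact congrArg Multiplicative.ofAdd hm.symm
    · refine ⟨SemidirectProduct.inl.comp (MonoidHom.inr _ _), fun a b hab => ?_, fun g m => ⟨?_, ?_⟩⟩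
      · exact (Prod.ext_iff.1 (SemidirectProduct.inl_injective hab)).2
      · rintro ⟨a, ha⟩
        obtain ⟨ha1, ha2⟩ := SemidirectProduct.ext_iff.1 ha
        exact ⟨(Multiplicative.ofAdd.injective ha2).symm,
          (Multiplicative.ofAdd.injective (Prod.ext_iff.1 ha1).1).symm⟩
      · rintro ⟨rfl, hm⟩
        refine ⟨Multiplicative.ofAdd (m 1), SemidirectProduct.ext (Prod.ext ?_ rfl) rfl⟩
        exact congrArg Multiplicative.ofAdd hm.symm
  obtain ⟨i, hi, hirange⟩ := hi
  refine nonempty_mulEquiv_of_range_eq Φ i hΦ hi (Set.ext fun v => ?_)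
  obtain ⟨g, m, rfl⟩ := exists_eq_shiftElement v
  rw [hrange, hirange, hadm]

/-- The case in which the ranges of the arguments are parallel half lines with end points `β k`. -/
theorem nonempty_mulEquiv_of_halfLines {β : ZMod 2 → ℝ}
    (hβ : ∀ k l c, ψ l '' Set.Ioo (s l) (t l) = (· + c) '' (ψ k '' Set.Ioo (s k) (t k)) ↔
      β l = β k + c) :
    (Complex.exp (β 0 * Complex.I) = Complex.exp (β 1 * Complex.I) →
      Nonempty (continuousInvariants B ≃* Multiplicative (ZMod 2))) ∧
    (Complex.exp (β 0 * Complex.I) ≠ Complex.exp (β 1 * Complex.I) →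
      Nonempty (continuousInvariants B ≃* Unit)) := by
  obtain ⟨Φ, hΦ, hrange⟩ := h.exists_monoidHom
  have hadm : ∀ g m, shiftElement g m ∈ Set.range Φ ↔
      ∀ k, β (k + g) = β k + m (k + g) * (2 * Real.pi) := fun g m =>
    (hrange g m).trans (forall_congr' fun k => hβ _ _ _)
  have hexp : ∀ x y : ℝ, Complex.exp (x * Complex.I) = Complex.exp (y * Complex.I) ↔
      ∃ n : ℤ, x = y + n * (2 * Real.pi) := by
    intro x y
    rw [← Circle.coe_exp, ← Circle.coe_exp, Circle.coe_inj, Circle.exp_eq_exp]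
  -- A half line is carried onto another by one translation only, so $g$ determines $m$.
  have huniq : ∀ x y, (Φ x).right = (Φ y).right → x = y := by
    intro x y hxy
    obtain ⟨g, m, hx⟩ := exists_eq_shiftElement (Φ x)
    obtain ⟨g', m', hy⟩ := exists_eq_shiftElement (Φ y)
    rw [hx, hy] at hxy
    obtain rfl : g = g' := Multiplicative.ofAdd.injective hxy
    have h1 := (hadm g m).1 ⟨x, hx⟩
    have h2 := (hadm g m').1 ⟨y, hy⟩
    have hm : m = m' := by
      funext l
      have h3 := h1 (l - g)
      rw [h2 (l - g), sub_add_cancel] at h3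
      have h4 := mul_right_cancel₀ Real.two_pi_pos.ne' (add_left_cancel h3)
      exact_mod_cast h4.symm
    exact hΦ (hx.trans (hm ▸ hy.symm))
  constructor
  · intro he
    obtain ⟨n, hn⟩ := (hexp _ _).1 he
    refine ⟨MulEquiv.ofBijective (SemidirectProduct.rightHom.comp Φ)
      ⟨fun x y hxy => huniq x y hxy, fun g => ?_⟩⟩
    rcases zmod_two_eq_zero_or_one g.toAdd with hg | hg
    · exact ⟨1, by rw [map_one]; exact congrArg Multiplicative.ofAdd hg.symm⟩
    · have h1 : shiftElement 1 (fun k => if k = 0 then n else -n) ∈ Set.range Φ := by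
        refine (hadm _ _).2 fun k => ?_
        rcases zmod_two_eq_zero_or_one k with rfl | rfl
        · simp only [zero_add, hn, one_ne_zero, if_false]
          push_cast
          ring
        · have h2 : (1 : ZMod 2) + 1 = 0 := by decide
          simp only [h2, if_true, hn]
      obtain ⟨x, hx⟩ := h1
      refine ⟨x, ?_⟩
      rw [MonoidHom.comp_apply, hx]
      exact congrArg Multiplicative.ofAdd hg.symm
  · intro hne
    have hright : ∀ x, (Φ x).right = 1 := by
      intro x
      obtain ⟨g, m, hx⟩ := exists_eq_shiftElement (Φ x)
      have h1 := (hadm g m).1 ⟨x, hx⟩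
      rcases zmod_two_eq_zero_or_one g with rfl | rfl
      · rw [hx]; rfl
      · refine absurd ((hexp _ _).2 ⟨m 0, ?_⟩) hne
        -- The equation for $k=1$, in which $1+1$ reduces to $0$.
        exact h1 1
    have : Unique (continuousInvariants B) :=
      ⟨⟨1⟩, fun x => huniq _ _ ((hright _).trans (hright _).symm)⟩
    exact ⟨MulEquiv.ofUnique⟩

end IsTwoArcArgument

/-! ### From the types of the arcs to the group -/

namespace IsTwoArcArgument

variable {B : ℂ → ℂ} {s t : ZMod 2 → ℝ} {ψ : ZMod 2 → ℝ → ℝ} (h : IsTwoArcArgument B s t ψ)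
include h

theorem nonempty_mulEquiv_of_bddAbove
    (h1 : ∀ k, ¬ BddBelow (ψ k '' Set.Ioo (s k) (t k)))
    (h2 : ∀ k, BddAbove (ψ k '' Set.Ioo (s k) (t k))) :
    ∃ L : ZMod 2 → ℂ, (∀ k, HasLimitFromBelow B (t k) (L k)) ∧
      (L 0 = L 1 → Nonempty (continuousInvariants B ≃* Multiplicative (ZMod 2))) ∧
      (L 0 ≠ L 1 → Nonempty (continuousInvariants B ≃* Unit)) := by
  refine ⟨_, fun k => (h.isArgumentOn k).hasLimitFromBelow (h2 k),
    h.nonempty_mulEquiv_of_halfLines (β := fun k => sSup (ψ k '' Set.Ioo (s k) (t k)))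
      fun k l c => ?_⟩
  conv_lhs => rw [(h.isArgumentOn l).image_eq_Iio (h1 l) (h2 l),
    (h.isArgumentOn k).image_eq_Iio (h1 k) (h2 k), Set.image_add_const_Iio, Set.Iio_inj]

theorem nonempty_mulEquiv_of_bddBelow
    (h1 : ∀ k, BddBelow (ψ k '' Set.Ioo (s k) (t k)))
    (h2 : ∀ k, ¬ BddAbove (ψ k '' Set.Ioo (s k) (t k))) :
    ∃ L : ZMod 2 → ℂ, (∀ k, HasLimitFromAbove B (s k) (L k)) ∧
      (L 0 = L 1 → Nonempty (continuousInvariants B ≃* Multiplicative (ZMod 2))) ∧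
      (L 0 ≠ L 1 → Nonempty (continuousInvariants B ≃* Unit)) := by
  refine ⟨_, fun k => (h.isArgumentOn k).hasLimitFromAbove (h1 k),
    h.nonempty_mulEquiv_of_halfLines (β := fun k => sInf (ψ k '' Set.Ioo (s k) (t k)))
      fun k l c => ?_⟩
  conv_lhs => rw [(h.isArgumentOn l).image_eq_Ioi (h1 l) (h2 l),
    (h.isArgumentOn k).image_eq_Ioi (h1 k) (h2 k), Set.image_add_const_Ioi, Set.Ioi_inj]

theorem nonempty_mulEquiv_of_isArcType2 (h1 : ∀ k, IsArcType2 B (s k) (t k)) :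
    Nonempty (continuousInvariants B ≃* ZSqSemidirectZTwo) :=
  h.nonempty_mulEquiv_semidirectProduct fun k =>
    have h2 := (h.isArgumentOn k).isArcType2_iff.1 (h1 k)
    (h.isArgumentOn k).image_eq_univ h2.1 h2.2

theorem nonempty_mulEquiv_of_isArcType2_of_not {k : ZMod 2} (h1 : IsArcType2 B (s k) (t k))
    (h2 : ¬ IsArcType2 B (s (k + 1)) (t (k + 1))) :
    Nonempty (continuousInvariants B ≃* Multiplicative ℤ) := by
  rw [(h.isArgumentOn _).isArcType2_iff] at h1 h2
  exact h.nonempty_mulEquiv_int ((h.isArgumentOn k).image_eq_univ h1.1 h1.2)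
    (by rwa [← not_and_or.trans (or_congr not_not not_not)])

/-- If no arc is of type `2` but the argument is unbounded at every singular point, then it is
unbounded at corresponding ends of the two arcs. -/
theorem bounds_of_not_isArcType2 (hunb : ∀ k, ¬ BddAbove (ψ (k + 1) '' Set.Ioo (s (k + 1)) (t (k + 1))) ∨
      ¬ BddBelow (ψ k '' Set.Ioo (s k) (t k)))
    (h2 : ∀ k, ¬ IsArcType2 B (s k) (t k)) :
    ((∀ k, ¬ BddBelow (ψ k '' Set.Ioo (s k) (t k))) ∧
      ∀ k, BddAbove (ψ k '' Set.Ioo (s k) (t k))) ∨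
    ((∀ k, BddBelow (ψ k '' Set.Ioo (s k) (t k))) ∧
      ∀ k, ¬ BddAbove (ψ k '' Set.Ioo (s k) (t k))) := by
  have h2' := fun k => mt (h.isArgumentOn k).isArcType2_iff.2 (h2 k)
  have hall : ∀ P : ZMod 2 → Prop, P 0 → P 1 → ∀ k, P k := fun P h0 h1 k => by
    rcases zmod_two_eq_zero_or_one k with rfl | rfl
    exacts [h0, h1]
  have e0 : (0 : ZMod 2) + 1 = 1 := by decide
  have e1 : (1 : ZMod 2) + 1 = 0 := by decide
  have u0 := hunb 0
  have u1 := hunb 1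
  have b0 := h2' 0
  have b1 := h2' 1
  rw [e0] at u0
  rw [e1] at u1
  -- If $\psi_0$ is bounded below, then $\psi_1$ is unbounded above, hence bounded below as arc $1$
  -- is not of type $2$, hence $\psi_0$ is unbounded above. The other case runs round the circle the
  -- other way.
  by_cases hb : BddBelow (ψ 0 '' Set.Ioo (s 0) (t 0))
  · right
    constructor <;> refine hall _ ?_ ?_ <;> tauto
  · left
    constructor <;> refine hall _ ?_ ?_ <;> tauto

end IsTwoArcArgument

/-! ### Application to Blaschke products with two singularities -/

theorem IsBlaschkeProduct.exists_isTwoArcArgument {B : ℂ → ℂ} (hB : IsBlaschkeProduct B)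
    {θ₀ θ₁ : ℝ} (h₀₁ : θ₀ < θ₁) (h₁₀ : θ₁ < θ₀ + 2 * Real.pi)
    (hspec : boundarySpectrum B = {Circle.exp θ₀, Circle.exp θ₁}) {s t : ZMod 2 → ℝ}
    (hs₀ : s 0 = θ₀) (hs₁ : s 1 = θ₁) (ht₀ : t 0 = θ₁) (ht₁ : t 1 = θ₀ + 2 * Real.pi) :
    ∃ ψ, IsTwoArcArgument B s t ψ ∧
      ∀ k, ¬ BddAbove (ψ (k + 1) '' Set.Ioo (s (k + 1)) (t (k + 1))) ∨
        ¬ BddBelow (ψ k '' Set.Ioo (s k) (t k)) := by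
  obtain ⟨c, p, a, hc, ha, hsum, hBz⟩ := hB
  have hseq : IsBlaschkeSequence a := ⟨fun j => (ha j).1, fun j => (ha j).2, hsum⟩
  have hform : ∀ z ∈ Metric.ball (0 : ℂ) 1, B z = blaschkeFormula c p a z := hBz
  have hc0 : c ≠ 0 := by rintro rfl; simp at hc
  have hall : ∀ P : ZMod 2 → Prop, P 0 → P 1 → ∀ k, P k := fun P h0 h1 k => by
    rcases zmod_two_eq_zero_or_one k with rfl | rfl
    exacts [h0, h1]
  have e0 : (0 : ZMod 2) + 1 = 1 := by decide
  have e1 : (1 : ZMod 2) + 1 = 0 := by decide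
  have hlt : ∀ k, s k < t k := hall _ (by rw [hs₀, ht₀]; exact h₀₁) (by rw [hs₁, ht₁]; exact h₁₀)
  have hlt' : ∀ k, t k < s k + 2 * Real.pi :=
    hall _ (by rw [hs₀, ht₀]; exact h₁₀) (by rw [hs₁, ht₁]; linarith)
  have hglue : ∀ k, Circle.exp (t k) = Circle.exp (s (k + 1)) :=
    hall _ (by rw [ht₀, e0, hs₁]) (by rw [ht₁, e1, hs₀, Circle.exp_add_two_pi])
  have hmem : ∀ ζ, ζ ∈ boundarySpectrum B ↔ ∃ k, ζ = Circle.exp (s k) := by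
    intro ζ
    rw [hspec]
    constructor
    · rintro (rfl | rfl)
      · exact ⟨0, by rw [hs₀]⟩
      · exact ⟨1, by rw [hs₁]⟩
    · rintro ⟨k, rfl⟩
      rcases zmod_two_eq_zero_or_one k with rfl | rfl
      · rw [hs₀]; exact Or.inl rfl
      · rw [hs₁]; exact Or.inr rfl
  have hsub : ∀ k, Set.Ico (s k) (t k) ⊆ Set.Ico θ₀ (θ₀ + 2 * Real.pi) :=
    hall _ (by rw [hs₀, ht₀]; exact Set.Ico_subset_Ico_right h₁₀.le)
      (by rw [hs₁, ht₁]; exact Set.Ico_subset_Ico_left h₀₁.le)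
  have hdisj : ∀ k l u, u ∈ Set.Ico (s k) (t k) → u ∈ Set.Ico (s l) (t l) → k = l := by
    intro k l u hk hl
    rcases zmod_two_eq_zero_or_one k with rfl | rfl <;>
      rcases zmod_two_eq_zero_or_one l with rfl | rfl
    · rfl
    · rw [ht₀] at hk; rw [hs₁] at hl
      exact absurd hl.1 hk.2.not_ge
    · rw [ht₀] at hl; rw [hs₁] at hk
      exact absurd hk.1 hl.2.not_ge
    · rfl
  have heq : ∀ k l, ∀ u ∈ Set.Ico (s k) (t k), ∀ v ∈ Set.Ico (s l) (t l),
      Circle.exp u = Circle.exp v → k = l ∧ u = v := by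
    intro k l u hu v hv huv
    have huv' := Circle.exp_injOn_Ico (by linarith) (hsub k hu) (hsub l hv) huv
    subst huv'
    exact ⟨hdisj k l u hu hv, rfl⟩
  have hcover : ∀ ζ, ∃ k, ∃ u ∈ Set.Ico (s k) (t k), Circle.exp u = ζ := by
    intro ζ
    obtain ⟨w, rfl⟩ := Circle.exp_surjective ζ
    obtain ⟨u, hu, huw⟩ := Circle.periodic_exp.exists_mem_Ico Real.two_pi_pos w θ₀
    rcases lt_or_ge u θ₁ with h1 | h1
    · exact ⟨0, u, by rw [hs₀, ht₀]; exact ⟨hu.1, h1⟩, huw.symm⟩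
    · exact ⟨1, u, by rw [hs₁, ht₁]; exact ⟨h1, hu.2⟩, huw.symm⟩
  have hreg : ∀ k, ∀ u ∈ Set.Ioo (s k) (t k), (Circle.exp u : ℂ) ∉ closure (Set.range a) := by
    intro k u hu
    refine hseq.notMem_closure_of_notMem_boundarySpectrum hform hc0 fun hsp => ?_
    obtain ⟨l, hl⟩ := (hmem _).1 hsp
    obtain ⟨rfl, rfl⟩ := heq k l u (Set.Ioo_subset_Ico_self hu) (s l)
      (Set.left_mem_Ico.2 (hlt l)) hl
    exact lt_irrefl _ hu.1
  choose ψ hψc hψm hψv hψi using fun k => hseq.exists_argument hform hc (hlt k) (hreg k)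
  refine ⟨ψ, ⟨fun k => ⟨hlt k, hlt' k, hψc k, hψm k, hψv k⟩, hglue, hcover, heq, hmem⟩, fun k => ?_⟩
  -- At $e^{is_k}$ arc $k+1$ ends and arc $k$ begins; the point is a limit of zeros, since otherwise
  -- $B$ would extend analytically there.
  refine hseq.not_bddAbove_or_not_bddBelow (hlt (k + 1)) (hlt k) ?_ ?_ (hψi (k + 1)) (hψi k)
  · rw [hglue]
    congr 3
    rw [add_assoc, show (1 : ZMod 2) + 1 = 0 from e1, add_zero]
  · by_contra hcl
    exact hseq.notMem_boundarySpectrum_of_notMem_closure hform hcl ((hmem _).2 ⟨k, rfl⟩)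

theorem mainTheorem3 (B : ℂ → ℂ) (hB : IsBlaschkeProduct B) (θ₀ θ₁ : ℝ)
    (h₀₁ : θ₀ < θ₁) (h₁₀ : θ₁ < θ₀ + 2 * Real.pi)
    (hspec : boundarySpectrum B = {Circle.exp θ₀, Circle.exp θ₁}) :
    -- The invariants form one of the four groups.
    (Nonempty (continuousInvariants B ≃* Unit) ∨
      Nonempty (continuousInvariants B ≃* Multiplicative (ZMod 2)) ∨
      Nonempty (continuousInvariants B ≃* Multiplicative ℤ) ∨
      Nonempty (continuousInvariants B ≃* ZSqSemidirectZTwo)) ∧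
    -- The semidirect product has the stated presentation.
    Nonempty (ZSqSemidirectZTwo ≃* PresentedGroup presentationRelators) ∧
    -- Each of the two arcs has one of the four types.
    (IsArcType0 B θ₀ θ₁ ∨ IsArcType1a B θ₀ θ₁ ∨ IsArcType1b B θ₀ θ₁ ∨ IsArcType2 B θ₀ θ₁) ∧
    (IsArcType0 B θ₁ (θ₀ + 2 * Real.pi) ∨ IsArcType1a B θ₁ (θ₀ + 2 * Real.pi) ∨
      IsArcType1b B θ₁ (θ₀ + 2 * Real.pi) ∨ IsArcType2 B θ₁ (θ₀ + 2 * Real.pi)) ∧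
    -- Both arcs of type 2.
    (IsArcType2 B θ₀ θ₁ ∧ IsArcType2 B θ₁ (θ₀ + 2 * Real.pi) →
      Nonempty (continuousInvariants B ≃* ZSqSemidirectZTwo)) ∧
    -- Exactly one arc of type 2.
    ((IsArcType2 B θ₀ θ₁ ∧ ¬ IsArcType2 B θ₁ (θ₀ + 2 * Real.pi)) ∨
        (¬ IsArcType2 B θ₀ θ₁ ∧ IsArcType2 B θ₁ (θ₀ + 2 * Real.pi)) →
      Nonempty (continuousInvariants B ≃* Multiplicative ℤ)) ∧
    -- No arc of type 2: both are of type 1a, or both of type 1b, and the one-sided limits on the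
    -- sides where the solutions do not accumulate exist and decide.
    (¬ IsArcType2 B θ₀ θ₁ ∧ ¬ IsArcType2 B θ₁ (θ₀ + 2 * Real.pi) →
      (IsArcType1a B θ₀ θ₁ ∧ IsArcType1a B θ₁ (θ₀ + 2 * Real.pi) ∧
        ∃ L₀ L₁ : ℂ, HasLimitFromBelow B θ₀ L₀ ∧ HasLimitFromBelow B θ₁ L₁ ∧
          (L₀ = L₁ → Nonempty (continuousInvariants B ≃* Multiplicative (ZMod 2))) ∧
          (L₀ ≠ L₁ → Nonempty (continuousInvariants B ≃* Unit))) ∨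
      (IsArcType1b B θ₀ θ₁ ∧ IsArcType1b B θ₁ (θ₀ + 2 * Real.pi) ∧
        ∃ L₀ L₁ : ℂ, HasLimitFromAbove B θ₀ L₀ ∧ HasLimitFromAbove B θ₁ L₁ ∧
          (L₀ = L₁ → Nonempty (continuousInvariants B ≃* Multiplicative (ZMod 2))) ∧
          (L₀ ≠ L₁ → Nonempty (continuousInvariants B ≃* Unit)))) := by
  obtain ⟨ψ, h, hunb⟩ := hB.exists_isTwoArcArgument h₀₁ h₁₀ hspec
    (s := fun k => if k = 0 then θ₀ else θ₁)
    (t := fun k => if k = 0 then θ₁ else θ₀ + 2 * Real.pi) rfl rfl rfl rfl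
  have hall : ∀ P : ZMod 2 → Prop, P 0 → P 1 → ∀ k, P k := fun P h0 h1 k => by
    rcases zmod_two_eq_zero_or_one k with rfl | rfl
    exacts [h0, h1]
  have hboth : IsArcType2 B θ₀ θ₁ ∧ IsArcType2 B θ₁ (θ₀ + 2 * Real.pi) →
      Nonempty (continuousInvariants B ≃* ZSqSemidirectZTwo) := fun h2 =>
    h.nonempty_mulEquiv_of_isArcType2 (hall _ h2.1 h2.2)
  have hone : (IsArcType2 B θ₀ θ₁ ∧ ¬ IsArcType2 B θ₁ (θ₀ + 2 * Real.pi)) ∨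
        (¬ IsArcType2 B θ₀ θ₁ ∧ IsArcType2 B θ₁ (θ₀ + 2 * Real.pi)) →
      Nonempty (continuousInvariants B ≃* Multiplicative ℤ) := by
    rintro (h2 | h2)
    · exact h.nonempty_mulEquiv_of_isArcType2_of_not (k := 0) h2.1 h2.2
    · exact h.nonempty_mulEquiv_of_isArcType2_of_not (k := 1) h2.2 h2.1
  have hnone : ¬ IsArcType2 B θ₀ θ₁ ∧ ¬ IsArcType2 B θ₁ (θ₀ + 2 * Real.pi) →
      (IsArcType1a B θ₀ θ₁ ∧ IsArcType1a B θ₁ (θ₀ + 2 * Real.pi) ∧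
        ∃ L₀ L₁ : ℂ, HasLimitFromBelow B θ₀ L₀ ∧ HasLimitFromBelow B θ₁ L₁ ∧
          (L₀ = L₁ → Nonempty (continuousInvariants B ≃* Multiplicative (ZMod 2))) ∧
          (L₀ ≠ L₁ → Nonempty (continuousInvariants B ≃* Unit))) ∨
      (IsArcType1b B θ₀ θ₁ ∧ IsArcType1b B θ₁ (θ₀ + 2 * Real.pi) ∧
        ∃ L₀ L₁ : ℂ, HasLimitFromAbove B θ₀ L₀ ∧ HasLimitFromAbove B θ₁ L₁ ∧
          (L₀ = L₁ → Nonempty (continuousInvariants B ≃* Multiplicative (ZMod 2))) ∧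
          (L₀ ≠ L₁ → Nonempty (continuousInvariants B ≃* Unit))) := by
    rintro ⟨h0, h1⟩
    rcases h.bounds_of_not_isArcType2 hunb (hall _ h0 h1) with ⟨hb, hb'⟩ | ⟨hb, hb'⟩
    · obtain ⟨L, hL, hL1, hL2⟩ := h.nonempty_mulEquiv_of_bddAbove hb hb'
      -- Limits from below belong to final points: arc $1$ ends at $e^{i\theta_0}$ and arc $0$ at
      -- $e^{i\theta_1}$, so the indices are interchanged.
      exact Or.inl ⟨(h.isArgumentOn 0).isArcType1a (hb 0) (hb' 0),
        (h.isArgumentOn 1).isArcType1a (hb 1) (hb' 1), L 1, L 0,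
        HasLimitFromBelow.of_add_two_pi (hL 1), hL 0,
        fun he => hL1 he.symm, fun he => hL2 he.symm⟩
    · obtain ⟨L, hL, hL1, hL2⟩ := h.nonempty_mulEquiv_of_bddBelow hb hb'
      exact Or.inr ⟨(h.isArgumentOn 0).isArcType1b (hb 0) (hb' 0),
        (h.isArgumentOn 1).isArcType1b (hb 1) (hb' 1), L 0, L 1, hL 0, hL 1, hL1, hL2⟩
  refine ⟨?_, nonempty_mulEquiv_presentedGroup, (h.isArgumentOn 0).isArcType,
    (h.isArgumentOn 1).isArcType, hboth, hone, hnone⟩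
  by_cases h0 : IsArcType2 B θ₀ θ₁ <;> by_cases h1 : IsArcType2 B θ₁ (θ₀ + 2 * Real.pi)
  · exact Or.inr (Or.inr (Or.inr (hboth ⟨h0, h1⟩)))
  · exact Or.inr (Or.inr (Or.inl (hone (Or.inl ⟨h0, h1⟩))))
  · exact Or.inr (Or.inr (Or.inl (hone (Or.inr ⟨h0, h1⟩))))
  · rcases hnone ⟨h0, h1⟩ with ⟨-, -, L₀, L₁, -, -, hL1, hL2⟩ | ⟨-, -, L₀, L₁, -, -, hL1, hL2⟩ <;>
    · by_cases hL : L₀ = L₁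
      · exact Or.inr (Or.inl (hL1 hL))
      · exact Or.inl (hL2 hL)
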